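/- Notation. A partition is a finite multiset of positive integers, written in decreasing order and, when convenient, padded with zeros; $|\lambda|$ is its size, $\lambda'$ its conjugate, and $\eta\cup\zeta$ is the partition whose multiplicities are the sums of those of $\eta$ and $\zeta$. Let $\mathscr P^{(2)}$ be the set of partitions $\lambda=(\lambda_1,\lambda_2)$ with at most two parts and $\widetilde{\mathscr P}^{(2)}$ the set of partitions all of whose parts are at most $2$. Put $\Delta=(2,1)$ and $\delta=(1,0)$. Let $s_\lambda=\sum_\mu K_{\lambda\mu}m_\mu$ be the expansion of Schur polynomials $s_\lambda=a_{\lambda+\delta_n}/a_{\delta_n}$ (in sufficiently many variables $n$, with $\delta_n=(n-1,\dots,1,0)$ and $a_\alpha=\sum_{\sigma\in\mathfrak S_n}\mathrm{sgn}(\sigma)\,\sigma(x^\alpha)$) in monomial symmetric polynomials, and let $(K^{-1}_{\lambda\mu})$ be the inverse of the Kostka matrix $(K_{\lambda\mu})$, indexed by all partitions; it vanishes unless $|\lambda|=|\mu|$. Let $x=(x_1,\dots,x_N)$ be a finite set of variables. Define $q_r(x)\in\mathbb Q[x_1,\dots,x_N]$ by $\sum_{r\ge0}q_r(x)t^r=\prod_{i=1}^N\frac{1+x_it}{1-x_it}$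 and $q_r(x)=0$ for $r<0$. Put $Q_{(r,s)}(x)=q_r(x)q_s(x)+2\sum_{i=1}^s(-1)^iq_{r+i}(x)q_{s-i}(x)$ for $(r,s)\ne(0,0)$, $Q_{(0,0)}(x)=0$, and $Q_\lambda(x)=\mathrm{Pf}\big(Q_{(\lambda_i,\lambda_j)}(x)\big)_{1\le i,j\le 2m}$ for $\lambda=(\lambda_1,\dots,\lambda_{2m})$ with $\lambda_1\ge\dots\ge\lambda_{2m-1}>0$, $\lambda_{2m}\ge0$; thus $Q_\lambda=Q_{(\lambda_1,\lambda_2)}$ for $m=1$. Let $Q_\lambda(x,x)$ be the same polynomial for the doubled set of variables $(x_1,\dots,x_N,x_1,\dots,x_N)$. Let $A_2$ be the set of $u=(u_1,u_2)\in(\mathbb Z_{\ge0})^2$ with $u_1\ne u_2$. For $u\in A_2$ let $\tau_u\in\mathfrak S_2$ be the permutation with $u_{\tau_u(2)}<u_{\tau_u(1)}$, and let $\tau_u^{-1}u-\delta=(u_{\tau_u(1)}-1,\,u_{\tau_u(2)})\in\mathscr P^{(2)}$. Theorem. For every $\xi\in\widetilde{\mathscr P}^{(2)}$ all of the following sums have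 only finitely many nonzero terms, and $$\sum_{u,v\in A_2}\mathrm{sgn}(\tau_u)\,\mathrm{sgn}(\tau_v)\,q_{2u_1}(x)q_{2u_2+1}(x)q_{2v_1}(x)q_{2v_2+1}(x)\sum_{\substack{\eta,\zeta\in\widetilde{\mathscr P}^{(2)}\\ \eta\cup\zeta=\xi}}K^{-1}_{\eta\,(\tau_u^{-1}u-\delta)'}K^{-1}_{\zeta\,(\tau_v^{-1}v-\delta)'}=\sum_{\lambda\in\mathscr P^{(2)}}2^{-2}K^{-1}_{\xi\lambda'}\,Q_{2\lambda+2\Delta}(x,x),$$ $$\sum_{u,v\in A_2}\mathrm{sgn}(\tau_u)\,\mathrm{sgn}(\tau_v)\,q_{2u_1-1}(x)q_{2u_2}(x)q_{2v_1}(x)q_{2v_2+1}(x)\sum_{\substack{\eta,\zeta\in\widetilde{\mathscr P}^{(2)}\\ \eta\cup\zeta=\xi}}K^{-1}_{\eta\,(\tau_u^{-1}u-\delta)'}K^{-1}_{\zeta\,(\tau_v^{-1}v-\delta)'}=\sum_{\lambda\in\mathscr P^{(2)}}2^{-2}K^{-1}_{\xi\lambda'}\,Q_{2\lambda+\Delta+\delta}(x,x).$$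 -/

import Mathlib

namespace SchurQ

/-! ### Partitions -/

/-- A partition: a finite multiset of positive integers. -/
@[ext] structure IntPartition where
  parts : Multiset ℕ
  pos : ∀ i ∈ parts, 0 < i

namespace IntPartition

/-- `|l|`, the sum of the parts. -/
def size (l : IntPartition) : ℕ := l.parts.sum

/-- The partition whose parts are the nonzero terms of a finite sequence. -/
def ofSeq {n : ℕ} (a : Fin n → ℕ) : IntPartition where
  parts := (Finset.univ.val.map a).filter (fun i => 0 < i)
  pos := fun _ hi => (Multiset.mem_filter.mp hi).2

/-- The conjugate partition, whose `j`-th part is the number of parts `≥ j` (for `j ≥ 1`); only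
`j ≤ |l|` can contribute a nonzero part. -/
def conj (l : IntPartition) : IntPartition where
  parts := ((Multiset.range l.size).map
    (fun j => Multiset.card (l.parts.filter (fun i => j + 1 ≤ i)))).filter (fun i => 0 < i)
  pos := fun _ hi => (Multiset.mem_filter.mp hi).2

/-- `l ∪ m`: multiplicities are added. -/
def union (l m : IntPartition) : IntPartition where
  parts := l.parts + m.parts
  pos := fun i hi => (Multiset.mem_add.mp hi).elim (l.pos i) (m.pos i)

/-- All parts are at most `n`. -/
def PartsLE (n : ℕ) (l : IntPartition) : Prop := ∀ i ∈ l.parts, i ≤ n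

/-- A partition, regarded as a partition of its size. -/
def toNatPartition (l : IntPartition) : Nat.Partition l.size where
  parts := l.parts
  parts_pos := fun {i} hi => l.pos i hi
  parts_sum := rfl

end IntPartition

/-- Partitions of length at most `n`, written as weakly decreasing sequences of `n` non-negative
integers. -/
abbrev PartSeq (n : ℕ) := {l : Fin n → ℕ // Antitone l}

/-- `δ = (n-1, n-2, …, 1, 0)`. -/
def delta (n : ℕ) (i : Fin n) : ℕ := n - 1 - i

/-- `Δ = (n, n-1, …, 2, 1)`. -/
def Delta (n : ℕ) (i : Fin n) : ℕ := n - i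

/-! ### Schur polynomials -/

noncomputable section

/-- The antisymmetric polynomial `a_α = ∑_σ sgn(σ) σ(x^α)` in `n` variables. -/
def alternant {n : ℕ} (α : Fin n → ℕ) : MvPolynomial (Fin n) ℚ :=
  ∑ σ : Equiv.Perm (Fin n), Equiv.Perm.sign σ • ∏ i, MvPolynomial.X (σ i) ^ α i

theorem alternant_eq_det {n : ℕ} (α : Fin n → ℕ) :
    alternant α = (Matrix.of fun j i : Fin n =>
      (MvPolynomial.X j : MvPolynomial (Fin n) ℚ) ^ α i).det := by
  rw [Matrix.det_apply]; rfl

theorem X_sub_X_dvd_alternant {n : ℕ} (α : Fin n → ℕ) {i j : Fin n} (hij : i ≠ j) :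
    (MvPolynomial.X j - MvPolynomial.X i : MvPolynomial (Fin n) ℚ) ∣ alternant α := by
  rw [← Ideal.mem_span_singleton, ← Ideal.Quotient.eq_zero_iff_mem, alternant_eq_det,
    RingHom.map_det]
  refine Matrix.det_zero_of_row_eq hij ?_
  funext k
  have h : Ideal.Quotient.mk (Ideal.span
      {(MvPolynomial.X j - MvPolynomial.X i : MvPolynomial (Fin n) ℚ)}) (MvPolynomial.X i)
      = Ideal.Quotient.mk _ (MvPolynomial.X j) := by
    rw [eq_comm, Ideal.Quotient.eq]
    exact Ideal.mem_span_singleton_self _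
  simp [h]

theorem irreducible_X_sub_X {n : ℕ} {i j : Fin n} (hij : i ≠ j) :
    Irreducible (MvPolynomial.X j - MvPolynomial.X i : MvPolynomial (Fin n) ℚ) := by
  have h := MvPolynomial.irreducible_sumSMulX
    (c := (Finsupp.single j (1 : ℚ) - Finsupp.single i 1 : Fin n →₀ ℚ))
    ⟨j, by simp [hij]⟩ (fun r hr => by
      have := hr j
      simp [hij] at this
      exact isUnit_iff_ne_zero.mpr this)
  simpa [MvPolynomial.sumSMulX] using h

theorem alternant_delta {n : ℕ} :
    alternant (delta n) = ∏ i : Fin n, ∏ j ∈ Finset.Ioi i,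
      (MvPolynomial.X i - MvPolynomial.X j : MvPolynomial (Fin n) ℚ) := by
  have h := Matrix.det_projVandermonde (fun _ : Fin n => (1 : MvPolynomial (Fin n) ℚ))
    MvPolynomial.X
  simp only [one_mul] at h
  rw [alternant_eq_det, ← h]
  congr 1
  ext1 j i
  have : n - 1 - (i : ℕ) = n - (i + 1) := by omega
  simp [Matrix.projVandermonde_apply, delta, Fin.val_rev, this]

theorem not_X_sub_X_dvd {n : ℕ} {i j k l : Fin n} (hij : i < j) (hkl : k < l)
    (h : (i, j) ≠ (k, l)) :
    ¬ (MvPolynomial.X i - MvPolynomial.X j : MvPolynomial (Fin n) ℚ) ∣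
      MvPolynomial.X k - MvPolynomial.X l := by
  intro hd
  have h1 := map_dvd (MvPolynomial.eval fun t : Fin n => if t = j then ((i : ℕ) : ℚ) else (t : ℕ)) hd
  simp only [map_sub, MvPolynomial.eval_X, hij.ne, if_true, if_false, sub_self,
    zero_dvd_iff, sub_eq_zero] at h1
  have h2 : (if k = j then i else k) = (if l = j then i else l) := by
    split_ifs at h1 ⊢ <;> first | rfl | (apply Fin.ext; exact_mod_cast h1)
  split_ifs at h2 with hk hl hl
  · exact hkl.ne (hk.trans hl.symm)
  · subst hk h2; exact lt_asymm hij hkl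
  · subst hl h2; exact h rfl
  · exact hkl.ne h2

theorem alternant_delta_dvd {n : ℕ} (α : Fin n → ℕ) : alternant (delta n) ∣ alternant α := by
  rw [alternant_delta, Finset.prod_sigma']
  refine Finset.prod_dvd_of_isRelPrime ?_ ?_
  · rintro ⟨i, j⟩ hij ⟨k, l⟩ hkl hne
    simp only [Finset.coe_sigma, Set.mem_sigma_iff, Finset.mem_coe, Finset.mem_univ,
      Finset.mem_Ioi, true_and] at hij hkl
    refine (irreducible_X_sub_X hij.ne').isRelPrime_iff_not_dvd.mpr
      (not_X_sub_X_dvd hij hkl ?_)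
    rintro h
    apply hne
    simp only [Prod.mk.injEq] at h
    obtain ⟨rfl, rfl⟩ := h
    rfl
  · rintro ⟨i, j⟩ hij
    simp only [Finset.mem_sigma, Finset.mem_univ, Finset.mem_Ioi, true_and] at hij
    exact X_sub_X_dvd_alternant α hij.ne'

/-- The Schur polynomial `s_l = a_{l+δ} / a_δ` in `n` variables: the quotient of the (exact)
division. -/
def schur {n : ℕ} (l : Fin n → ℕ) : MvPolynomial (Fin n) ℚ :=
  (alternant_delta_dvd (fun i => l i + delta n i)).choose

theorem alternant_delta_mul_schur {n : ℕ} (l : Fin n → ℕ) :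
    alternant (delta n) * schur l = alternant (fun i => l i + delta n i) :=
  (alternant_delta_dvd (fun i => l i + delta n i)).choose_spec.symm

/-! ### The Kostka matrix and its inverse -/

/-- The parts of a partition of `d` in decreasing order, followed by zeros, as a sequence of
length `d`. -/
def rowSeq {d : ℕ} (l : Nat.Partition d) (i : Fin d) : ℕ :=
  (l.parts.sort (fun a b => b ≤ a)).getD i 0

/-- The Kostka matrix on partitions of `d`: `K_{l m}` is the coefficient of the monomial symmetric
polynomial `m_m` in the Schur polynomial `s_l`, that is, the coefficient of `x^m` in `s_l`. Every
partition of `d` has at most `d` parts, so `d` variables are enough. -/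
def kostka (d : ℕ) : Matrix (Nat.Partition d) (Nat.Partition d) ℚ :=
  Matrix.of fun l m => (schur (rowSeq l)).coeff (Finsupp.equivFunOnFinite.symm (rowSeq m))

/-- The sequence of exponents `α` as a finitely supported function. -/
abbrev expo {n : ℕ} (α : Fin n → ℕ) : Fin n →₀ ℕ := Finsupp.equivFunOnFinite.symm α

theorem alternant_eq_sum_monomial {n : ℕ} (α : Fin n → ℕ) :
    alternant α = ∑ σ : Equiv.Perm (Fin n),
      Equiv.Perm.sign σ • MvPolynomial.monomial (expo (α ∘ σ.symm)) (1 : ℚ) := by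
  unfold alternant
  refine Finset.sum_congr rfl fun σ _ => ?_
  congr 1
  rw [MvPolynomial.monomial_eq, Finsupp.prod_fintype _ _ (by simp), 
    ← Equiv.prod_comp σ (fun j => (MvPolynomial.X j : MvPolynomial (Fin n) ℚ) ^ _)]
  simp

theorem perm_lt {n : ℕ} {α : Fin n → ℕ} (hα : StrictAnti α) {σ : Equiv.Perm (Fin n)}
    (hσ : σ ≠ 1) :
    (MonomialOrder.lex (σ := Fin n)).toSyn (expo (α ∘ σ)) <
      (MonomialOrder.lex (σ := Fin n)).toSyn (expo α) := by
  rw [MonomialOrder.lex_lt_iff]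
  change Pi.Lex _ _ _ _
  have hne : (Finset.univ.filter fun i => σ i ≠ i).Nonempty := by
    by_contra h
    rw [Finset.not_nonempty_iff_eq_empty, Finset.filter_eq_empty_iff] at h
    exact hσ (Equiv.ext fun i => by simpa using h (Finset.mem_univ i))
  refine ⟨(Finset.univ.filter fun i => σ i ≠ i).min' hne, ?_, ?_⟩
  all_goals
    set i := (Finset.univ.filter fun i => σ i ≠ i).min' hne with hi
    have hmin : ∀ j < i, σ j = j := fun j hj => by
      by_contra h
      exact absurd (Finset.min'_le _ j (by simp [h])) (not_le.mpr hj)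
    have hi' : σ i ≠ i := by
      have := Finset.min'_mem _ hne
      rw [← hi] at this
      simpa using this
  · intro j hj
    simp [hmin j hj]
  · have : i < σ i := by
      rcases lt_trichotomy (σ i) i with h | h | h
      · exact absurd (σ.injective (hmin _ h)) hi'
      · exact absurd h hi'
      · exact h
    simpa using hα this

theorem coeff_alternant_self {n : ℕ} {α : Fin n → ℕ} (hα : StrictAnti α) :
    (alternant α).coeff (expo α) = 1 := by
  rw [alternant_eq_sum_monomial, MvPolynomial.coeff_sum, Finset.sum_eq_single 1]
  · have h1 : α ∘ (1 : Equiv.Perm (Fin n)).symm = α := rfl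
    simp [MvPolynomial.coeff_monomial, h1]
  · intro σ _ hσ
    have h := (perm_lt hα (σ := σ.symm) (by
      intro h; apply hσ; rw [← σ.symm_symm, h]; rfl)).ne
    have h' : expo (α ∘ σ.symm) ≠ expo α := fun h' => h (by rw [h'])
    rw [Units.smul_def, MvPolynomial.coeff_smul, MvPolynomial.coeff_monomial, if_neg h', smul_zero]
  · simp

theorem degree_alternant {n : ℕ} {α : Fin n → ℕ} (hα : StrictAnti α) :
    MonomialOrder.lex.degree (alternant α) = expo α := by
  apply MonomialOrder.lex.toSyn.injective
  apply le_antisymm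
  · rw [MonomialOrder.degree_le_iff]
    intro e he
    rw [alternant_eq_sum_monomial] at he
    obtain ⟨σ, -, hσ⟩ := Finset.exists_ne_zero_of_sum_ne_zero (by
      rwa [MvPolynomial.mem_support_iff, MvPolynomial.coeff_sum] at he)
    rw [Units.smul_def, MvPolynomial.coeff_smul, MvPolynomial.coeff_monomial] at hσ
    have he' : expo (α ∘ σ.symm) = e := by
      by_contra h
      simp [h] at hσ
    subst he'
    by_cases h : σ.symm = 1
    · rw [h]; exact le_of_eq rfl
    · exact (perm_lt hα h).le
  · apply MonomialOrder.le_degree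
    rw [MvPolynomial.mem_support_iff, coeff_alternant_self hα]
    exact one_ne_zero

theorem strictAnti_delta (n : ℕ) : StrictAnti (delta n) := by
  intro i j h
  have := j.isLt
  have : (i : ℕ) < j := h
  simp only [delta]
  omega

theorem degree_schur {n : ℕ} {l : Fin n → ℕ} (hl : Antitone l) :
    MonomialOrder.lex.degree (schur l) = expo l ∧ (schur l).coeff (expo l) = 1 := by
  have hs : StrictAnti (fun i => l i + delta n i) := fun i j h =>
    add_lt_add_of_le_of_lt (hl h.le) (strictAnti_delta n h)
  have h := alternant_delta_mul_schur l
  have hne : alternant (fun i => l i + delta n i) ≠ 0 := fun h0 => by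
    have := coeff_alternant_self hs
    simp [h0] at this
  have hne' := hne
  rw [← h] at hne'
  have hd := congrArg MonomialOrder.lex.degree h
  rw [MonomialOrder.degree_mul (left_ne_zero_of_mul hne') (right_ne_zero_of_mul hne'),
    degree_alternant (strictAnti_delta n), degree_alternant hs] at hd
  have hd' : MonomialOrder.lex.degree (schur l) = expo l := by
    ext i
    have := DFunLike.congr_fun hd i
    simp only [Finsupp.add_apply, Finsupp.equivFunOnFinite_symm_apply_apply] at this ⊢
    omega
  refine ⟨hd', ?_⟩
  have hc := congrArg MonomialOrder.lex.leadingCoeff h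
  rw [MonomialOrder.leadingCoeff_mul] at hc
  simp only [MonomialOrder.leadingCoeff, degree_alternant (strictAnti_delta n),
    degree_alternant hs, hd', coeff_alternant_self (strictAnti_delta n),
    coeff_alternant_self hs, one_mul] at hc
  exact hc

theorem antitone_rowSeq {d : ℕ} (l : Nat.Partition d) : Antitone (rowSeq l) := by
  intro i j hij
  have hp := l.parts.pairwise_sort (fun a b => b ≤ a)
  rw [List.pairwise_iff_getElem] at hp
  simp only [rowSeq, List.getD_eq_getElem?_getD]
  by_cases hj : (j : ℕ) < (l.parts.sort (fun a b => b ≤ a)).length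
  · have hi := lt_of_le_of_lt (show (i : ℕ) ≤ j from hij) hj
    rw [List.getElem?_eq_getElem hi, List.getElem?_eq_getElem hj]
    rcases eq_or_lt_of_le (show (i : ℕ) ≤ j from hij) with h | h
    · simp [h]
    · exact hp _ _ hi hj h
  · rw [List.getElem?_eq_none (not_lt.mp hj)]
    exact Nat.zero_le _

theorem rowSeq_injective (d : ℕ) : Function.Injective (rowSeq (d := d)) := by
  have hlen : ∀ l : Nat.Partition d, (l.parts.sort (fun a b => b ≤ a)).length ≤ d := fun l => by
    have h := Multiset.card_nsmul_le_sum (s := l.parts) (a := 1) (fun x hx => l.parts_pos hx)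
    rw [l.parts_sum] at h
    simpa using h
  have hpos : ∀ (l : Nat.Partition d) (i : ℕ),
      i < (l.parts.sort (fun a b => b ≤ a)).length ↔
        0 < (l.parts.sort (fun a b => b ≤ a)).getD i 0 := fun l i => by
    constructor
    · intro h
      rw [List.getD_eq_getElem _ _ h]
      exact l.parts_pos ((Multiset.mem_sort _).mp (List.getElem_mem h))
    · intro h
      by_contra h'
      rw [List.getD_eq_default _ _ (not_lt.mp h')] at h
      exact lt_irrefl _ h
  intro l m h
  have hD : ∀ i, (l.parts.sort (fun a b => b ≤ a)).getD i 0 =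
      (m.parts.sort (fun a b => b ≤ a)).getD i 0 := fun i => by
    by_cases hi : i < d
    · exact congrFun h ⟨i, hi⟩
    · rw [List.getD_eq_default _ _ ((hlen l).trans (not_lt.mp hi)),
        List.getD_eq_default _ _ ((hlen m).trans (not_lt.mp hi))]
  have hL : l.parts.sort (fun a b => b ≤ a) = m.parts.sort (fun a b => b ≤ a) := by
    have hll : ∀ i, i < (l.parts.sort (fun a b => b ≤ a)).length ↔
        i < (m.parts.sort (fun a b => b ≤ a)).length := fun i => by
      rw [hpos, hpos, hD]
    refine List.ext_getElem ?_ fun i h1 h2 => ?_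
    · exact eq_of_forall_lt_iff hll
    · have := hD i
      rwa [List.getD_eq_getElem _ _ h1, List.getD_eq_getElem _ _ h2] at this
  ext1
  rw [← l.parts.sort_eq (fun a b => b ≤ a), hL, Multiset.sort_eq]

/-- The Kostka matrix is unitriangular, so that its inverse below is a genuine inverse. -/
theorem det_kostka (d : ℕ) : (kostka d).det = 1 := by
  classical
  let b : Nat.Partition d → (MonomialOrder.lex (σ := Fin d)).synᵒᵈ := fun l =>
    OrderDual.toDual (MonomialOrder.lex.toSyn (expo (rowSeq l)))
  have hb : Function.Injective b := fun l m h =>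
    rowSeq_injective d (Finsupp.equivFunOnFinite.symm.injective
      (MonomialOrder.lex.toSyn.injective (OrderDual.toDual.injective h)))
  have htri : (kostka d).BlockTriangular b := fun l m h => by
    have h' : MonomialOrder.lex.toSyn (MonomialOrder.lex.degree (schur (rowSeq l))) <
        MonomialOrder.lex.toSyn (expo (rowSeq m)) := by
      rw [(degree_schur (antitone_rowSeq l)).1]; exact h
    exact MonomialOrder.coeff_eq_zero_of_lt h'
  rw [htri.det]
  refine Finset.prod_eq_one fun a ha => ?_
  obtain ⟨l, -, rfl⟩ := Finset.mem_image.mp ha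
  let _ : Unique {i // b i = b l} := ⟨⟨⟨l, rfl⟩⟩, fun m => Subtype.ext (hb m.2)⟩
  rw [Matrix.det_unique]
  exact (degree_schur (antitone_rowSeq l)).2

/-- The entry `K⁻¹_{l m}` of the inverse Kostka matrix on all partitions, which is block diagonal
with respect to the size. -/
def kostkaInv (l m : IntPartition) : ℚ :=
  if h : l.size = m.size then
    (kostka m.size)⁻¹ ⟨l.parts, fun {i} hi => l.pos i hi, h⟩ m.toNatPartition
  else 0

theorem kostka_mul_inv (d : ℕ) : kostka d * (kostka d)⁻¹ = 1 :=
  Matrix.mul_nonsing_inv _ (by rw [det_kostka]; exact isUnit_one)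

theorem kostka_inv_mul (d : ℕ) : (kostka d)⁻¹ * kostka d = 1 :=
  Matrix.nonsing_inv_mul _ (by rw [det_kostka]; exact isUnit_one)

/-! ### The polynomials `q_r` and Schur's `Q`-polynomials -/

/-- The generating series `∏_i (1 + x_i t) (1 + x_i t + x_i^2 t^2 + ⋯) = ∏_i (1 + x_i t)/(1 - x_i t)`
of a finite family `x`. -/
def qSeries {ι R : Type*} [Fintype ι] [CommRing R] (x : ι → R) : PowerSeries R :=
  ∏ i, (1 + PowerSeries.C (x i) * PowerSeries.X) * PowerSeries.mk fun k => x i ^ k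

/-- `q_r(x)`, the coefficient of `t^r` in the generating series; zero for `r < 0`. -/
def q {ι R : Type*} [Fintype ι] [CommRing R] (x : ι → R) (r : ℤ) : R :=
  if 0 ≤ r then PowerSeries.coeff r.toNat (qSeries x) else 0

/-- `Q_{(r,s)}(x)`. -/
def Q₂ {ι R : Type*} [Fintype ι] [CommRing R] (x : ι → R) (r s : ℕ) : R :=
  if r = 0 ∧ s = 0 then 0
  else q x r * q x s + 2 * ∑ i ∈ Finset.Icc 1 s, (-1) ^ i * q x (r + i) * q x (s - i)

/-- The Pfaffian of a skew-symmetric matrix of size `2m`: the sum of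
`sgn(σ) ∏_i A_{σ(2i-1) σ(2i)}` over the permutations `σ` with `σ(2i-1) < σ(2i)` for all `i` and
`σ(1) < σ(3) < ⋯ < σ(2m-1)`. -/
def pfaffian {R : Type*} [CommRing R] {m : ℕ} (A : Matrix (Fin (2 * m)) (Fin (2 * m)) R) : R :=
  ∑ σ : Equiv.Perm (Fin (2 * m)) with
      (∀ i : Fin m, σ ⟨2 * i, by omega⟩ < σ ⟨2 * i + 1, by omega⟩) ∧
      (∀ i j : Fin m, i < j → σ ⟨2 * i, by omega⟩ < σ ⟨2 * j, by omega⟩),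
    Equiv.Perm.sign σ • ∏ i : Fin m, A (σ ⟨2 * i, by omega⟩) (σ ⟨2 * i + 1, by omega⟩)

/-- Schur's `Q`-polynomial `Q_l(x)` of a partition `l = (l_1, …, l_{2m})`, of which only the last
term may be zero. -/
def schurQ {ι R : Type*} [Fintype ι] [CommRing R] (x : ι → R) (m : ℕ) (l : Fin (2 * m) → ℕ) : R :=
  pfaffian (Matrix.of fun i j => Q₂ x (l i) (l j))

/-! ### Index sets of the sums -/

/-- `A_2`: pairs `u = (u_1, u_2)` of distinct non-negative integers. -/
abbrev A₂ := {u : Fin 2 → ℕ // u 0 ≠ u 1}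

/-- The permutation `τ_u` with `u_{τ_u(2)} < u_{τ_u(1)}`. -/
def tau (u : A₂) : Equiv.Perm (Fin 2) := if u.1 1 < u.1 0 then 1 else Equiv.swap 0 1

theorem tau_spec (u : A₂) : u.1 (tau u 1) < u.1 (tau u 0) := by
  have := u.2
  unfold tau
  split_ifs with h
  · exact h
  · simp; omega

/-- `sgn(τ_u)`. -/
def sgnTau (u : A₂) : ℚ := ((Equiv.Perm.sign (tau u) : ℤ) : ℚ)

/-- The partition `τ_u⁻¹ u - δ = (u_{τ_u(1)} - 1, u_{τ_u(2)})`. -/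
def straighten (u : A₂) : IntPartition :=
  IntPartition.ofSeq fun i => u.1 (tau u i) - delta 2 i

/-- The pairs `(η, ζ)` of partitions with parts at most `n` such that `η ∪ ζ = ξ`. -/
def unionPairs (n : ℕ) (ξ : IntPartition) : Set (IntPartition × IntPartition) :=
  {p | p.1.PartsLE n ∧ p.2.PartsLE n ∧ p.1.union p.2 = ξ}

theorem finite_unionPairs (n : ℕ) (ξ : IntPartition) : (unionPairs n ξ).Finite := by
  have hinj : Function.Injective
      (fun p : IntPartition × IntPartition => (p.1.parts, p.2.parts)) := by
    rintro ⟨a, b⟩ ⟨c, d⟩ h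
    simp only [Prod.mk.injEq] at h
    exact Prod.ext (IntPartition.ext h.1) (IntPartition.ext h.2)
  refine Set.Finite.of_finite_image (f := fun p => (p.1.parts, p.2.parts)) ?_ hinj.injOn
  refine ((Set.finite_Iic ξ.parts).prod (Set.finite_Iic ξ.parts)).subset ?_
  rintro _ ⟨p, ⟨-, -, rfl⟩, rfl⟩
  exact ⟨Multiset.le_add_right _ _, Multiset.le_add_left _ _⟩

/-- The sum of `K⁻¹_{η α'} K⁻¹_{ζ β'}` over all `η ∪ ζ = ξ` with `η`, `ζ` having parts at most `2`
(a finite sum). -/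
def kostkaConv (ξ α β : IntPartition) : ℚ :=
  ∑ᶠ p ∈ unionPairs 2 ξ, kostkaInv p.1 α.conj * kostkaInv p.2 β.conj

end
end SchurQ

open SchurQ

/-!
The theorem is an identity of coefficients in the ring of symmetric polynomials in two auxiliary
variables `y`, `z`.

If `ξ = 2^a 1^b` and `l` has at most two rows, then `K⁻¹_{ξ l'}` is the coefficient of
`e_ξ = e_1^b e_2^a` in the Schur polynomial `s_l(y, z)` (`kostkaInv_conj`). To see this, compare
coefficients in `a_δ s_ν = a_{ν+δ}`: the inverse Kostka number `K⁻¹_{ξ λ}` counts, with signs, the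
permutations `σ` for which `λ + δ - σ(δ)` is a rearrangement of `ξ` (`kostka_inv_eq`). Hence
`∑_ξ K⁻¹_{ξ λ} h_ξ = det (h_{λ_i - i + j})` for any numbers `h_k` with `h_0 = 1`
(`sum_kostka_inv_smul_prod`). For `h_1 = e_1`, `h_2 = e_2`, `h_k = 0` for `k > 2` and `λ = 2^p 1^q`
the determinant is `e_2^p h_q(y, z)`, which is the Schur polynomial `s_{(p+q,p)}(y, z)`.

Therefore the left sides are coefficients of `e_ξ` in products of two series of Schur polynomials,
and the right sides are coefficients in one such series (`finsum_kostkaConv`, `finsum_kostkaInv`).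
After multiplication by `(y - z)²` the Schur polynomials become differences of monomials. Write
`∑ q_r t^r = A(t²) + t B(t²)`. The left sides become the products `G²` and `H G`, where
`G = A(y) B(z) - A(z) B(y)` and `H = y B(y) A(z) - z B(z) A(y)`, and the right sides become
`(y - z) / 4` times generating series of the values `Q_{(r,s)}(x,x)` with `r`, `s` both even or both
odd. These generating series are known from a recursion for `Q_{(r,s)}` (`Q₂_sub_Q₂`), from the fact
that doubling the variables squares `∑ q_r t^r`, and from `A(t)² - t B(t)² = 1`; this gives
`X_mul_biSeries_even` and `X_mul_biSeries_odd`.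

All power series carry one formal variable which records the total degree, so that the infinite sums
over `u`, `v` and `l` become finite in each degree.
-/

namespace SchurQ

noncomputable section

/-! ### Rearrangements of the rows of a partition -/

theorem exists_perm_of_map_eq {n : ℕ} {f g : Fin n → ℕ}
    (h : Finset.univ.val.map f = Finset.univ.val.map g) :
    ∃ σ : Equiv.Perm (Fin n), f = g ∘ σ := by
  have key : f ∘ Tuple.sort f = g ∘ Tuple.sort g := by
    apply List.ofFn_injective
    refine List.Perm.eq_of_pairwise (le := (· ≤ ·)) (fun a b _ _ hab hba => le_antisymm hab hba)
      (Tuple.monotone_sort f).sortedLE_ofFn.pairwise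
      (Tuple.monotone_sort g).sortedLE_ofFn.pairwise ?_
    refine (Equiv.Perm.ofFn_comp_perm _ _).trans
      (List.Perm.trans ?_ (Equiv.Perm.ofFn_comp_perm _ _).symm)
    rw [Fin.univ_val_map, Fin.univ_val_map] at h
    exact Multiset.coe_eq_coe.mp h
  refine ⟨(Tuple.sort f).symm.trans (Tuple.sort g), ?_⟩
  have := congrArg (fun k => k ∘ (Tuple.sort f).symm) key
  simp only [Function.comp_assoc, Equiv.self_comp_symm, Function.comp_id] at this
  exact this

theorem card_parts_le {d : ℕ} (l : Nat.Partition d) : Multiset.card l.parts ≤ d := by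
  have h := Multiset.card_nsmul_le_sum (s := l.parts) (a := 1) (fun x hx => l.parts_pos hx)
  rw [l.parts_sum] at h
  simpa using h

/-- The terms of `rowSeq l` are the parts of `l`, padded by zeros up to length `d`. -/
theorem map_rowSeq {d : ℕ} (l : Nat.Partition d) :
    Finset.univ.val.map (rowSeq l) =
      l.parts + Multiset.replicate (d - Multiset.card l.parts) 0 := by
  have hl := card_parts_le l
  conv_rhs => rw [← l.parts.sort_eq (fun a b => b ≤ a)]
  rw [Fin.univ_val_map, ← Multiset.coe_replicate, Multiset.coe_add, Multiset.coe_eq_coe]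
  refine List.Perm.of_eq (List.ext_getElem (by simp; omega) fun i h1 h2 => ?_)
  simp only [List.getElem_ofFn, rowSeq, List.getElem_append, List.getElem_replicate]
  split_ifs with h
  · exact List.getD_eq_getElem _ _ h
  · exact List.getD_eq_default _ _ (not_lt.mp h)

theorem prod_rowSeq {M : Type*} [CommMonoid M] {d : ℕ} (l : Nat.Partition d) (h : ℕ → M)
    (h0 : h 0 = 1) : ∏ i, h (rowSeq l i) = (l.parts.map h).prod := by
  have := congrArg (fun s => (s.map h).prod) (map_rowSeq l)
  simpa [h0, Function.comp_def, List.prod_ofFn] using this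

theorem exists_perm_rowSeq {d : ℕ} (β : Fin d → ℕ) (hβ : (Finset.univ.val.map β).sum = d) :
    ∃ σ : Equiv.Perm (Fin d),
      rowSeq (Nat.Partition.ofSums d (Finset.univ.val.map β) hβ) = β ∘ σ := by
  apply exists_perm_of_map_eq
  rw [map_rowSeq, Nat.Partition.ofSums_parts]
  set m := Finset.univ.val.map β with hm
  have hc : Multiset.card m = d := by simp [hm]
  have h1 := Multiset.filter_add_not (fun i => i ≠ 0) m
  have h2 : m.filter (fun i => ¬ i ≠ 0) =
      Multiset.replicate (Multiset.card (m.filter (fun i => ¬ i ≠ 0))) 0 :=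
    Multiset.eq_replicate_card.mpr fun b hb => by simpa using (Multiset.mem_filter.mp hb).2
  have h3 := congrArg Multiset.card h1
  rw [Multiset.card_add, hc] at h3
  conv_rhs => rw [← h1, h2]
  congr 2
  omega

/-! ### Symmetry of Schur polynomials -/

theorem rename_alternant {n : ℕ} (α : Fin n → ℕ) (σ : Equiv.Perm (Fin n)) :
    MvPolynomial.rename σ (alternant α) = Equiv.Perm.sign σ • alternant α := by
  unfold alternant
  rw [map_sum, Finset.smul_sum]
  conv_rhs => rw [← Equiv.sum_comp (Equiv.mulLeft σ)]
  refine Finset.sum_congr rfl fun τ _ => ?_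
  rw [Units.smul_def, Units.smul_def, Units.smul_def, map_zsmul, smul_smul]
  have hs : ((Equiv.Perm.sign σ : ℤˣ) : ℤ) * (Equiv.Perm.sign (Equiv.mulLeft σ τ) : ℤˣ)
      = (Equiv.Perm.sign τ : ℤˣ) := by
    rw [Equiv.coe_mulLeft, Equiv.Perm.sign_mul, ← Units.val_mul, ← mul_assoc, Int.units_mul_self,
      one_mul]
  rw [hs]
  simp [map_prod]

theorem alternant_ne_zero {n : ℕ} {α : Fin n → ℕ} (hα : StrictAnti α) : alternant α ≠ 0 :=
  fun h => by simpa [h] using coeff_alternant_self hα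

/-- A Schur polynomial is a quotient of two antisymmetric polynomials. -/
theorem rename_schur {n : ℕ} (l : Fin n → ℕ) (σ : Equiv.Perm (Fin n)) :
    MvPolynomial.rename σ (schur l) = schur l := by
  have h := alternant_delta_mul_schur l
  apply mul_left_cancel₀ (alternant_ne_zero (strictAnti_delta n))
  have h1 := congrArg (MvPolynomial.rename σ) h
  rw [map_mul, rename_alternant, rename_alternant, ← h, smul_mul_assoc] at h1
  exact MulAction.injective _ h1

/-- The coefficients of a Schur polynomial do not change when the exponents are permuted. -/
theorem coeff_schur_comp {n : ℕ} (l β : Fin n → ℕ) (σ : Equiv.Perm (Fin n)) :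
    (schur l).coeff (expo (β ∘ σ)) = (schur l).coeff (expo β) := by
  conv_rhs => rw [← rename_schur l σ]
  have : expo β = (expo (β ∘ σ)).mapDomain σ := by
    ext i
    obtain ⟨j, rfl⟩ := σ.surjective i
    rw [Finsupp.mapDomain_apply σ.injective]
    simp
  rw [this, MvPolynomial.coeff_rename_mapDomain _ σ.injective]

theorem coeff_alternant {n : ℕ} {α β : Fin n → ℕ} (hα : StrictAnti α) (hβ : StrictAnti β) :
    (alternant α).coeff (expo β) = if α = β then 1 else 0 := by
  split_ifs with h
  · rw [← h, coeff_alternant_self hα]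
  · rw [alternant_eq_sum_monomial, MvPolynomial.coeff_sum]
    refine Finset.sum_eq_zero fun σ _ => ?_
    rw [Units.smul_def, MvPolynomial.coeff_smul, MvPolynomial.coeff_monomial, if_neg, smul_zero]
    intro he
    have he' : α ∘ σ.symm = β := Finsupp.equivFunOnFinite.symm.injective he
    -- a permutation carrying one strictly decreasing sequence to another is the identity
    have hm : StrictMono σ.symm := fun i j hij => hα.lt_iff_gt.mp (by
      have := hβ hij
      rwa [← he'] at this)
    have : σ.symm = 1 := by
      ext i
      have := (Subsingleton.elim (OrderIso.ofSurjective (OrderEmbedding.ofStrictMono σ.symm hm)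
        σ.symm.surjective) (OrderIso.refl _) : _ = OrderIso.refl (Fin n))
      exact congrArg (fun e : Fin n ≃o Fin n => ((e i : Fin n) : ℕ)) this
    rw [this] at he'
    exact h he'

/-! ### The inverse Kostka matrix -/

/-- The sequence `l + δ - σ(δ)`, with truncated subtraction; it is meaningful under
`ShiftAdmissible l σ`. -/
def shiftSeq {d : ℕ} (l : Fin d → ℕ) (σ : Equiv.Perm (Fin d)) (i : Fin d) : ℕ :=
  l i + delta d i - delta d (σ i)

/-- The terms of `l + δ - σ(δ)` are non-negative. -/
def ShiftAdmissible {d : ℕ} (l : Fin d → ℕ) (σ : Equiv.Perm (Fin d)) : Prop :=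
  ∀ i, delta d (σ i) ≤ l i + delta d i

theorem sum_rowSeq {d : ℕ} (l : Nat.Partition d) : ∑ i, rowSeq l i = d := by
  have := congrArg Multiset.sum (map_rowSeq l)
  simpa [l.parts_sum, List.sum_ofFn] using this

theorem sum_shiftSeq {d : ℕ} (l : Nat.Partition d) {σ : Equiv.Perm (Fin d)}
    (h : ShiftAdmissible (rowSeq l) σ) :
    (Finset.univ.val.map (shiftSeq (rowSeq l) σ)).sum = d := by
  change ∑ i, shiftSeq (rowSeq l) σ i = d
  have h1 : ∑ i, (shiftSeq (rowSeq l) σ i + delta d (σ i)) = ∑ i, (rowSeq l i + delta d i) :=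
    Finset.sum_congr rfl fun i _ => Nat.sub_add_cancel (h i)
  rw [Finset.sum_add_distrib, Finset.sum_add_distrib, Equiv.sum_comp σ (delta d),
    sum_rowSeq] at h1
  omega

open Classical in
/-- The signed number of permutations `σ` for which `l + δ - σ(δ)` is a rearrangement of `m`. It
turns out to be the inverse Kostka number `K⁻¹_{m l}`. -/
def signedShiftCount (d : ℕ) : Matrix (Nat.Partition d) (Nat.Partition d) ℚ :=
  Matrix.of fun m l => ∑ σ : Equiv.Perm (Fin d), Equiv.Perm.sign σ •
    if ∃ h : ShiftAdmissible (rowSeq l) σ, m = Nat.Partition.ofSums d _ (sum_shiftSeq l h)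
    then (1 : ℚ) else 0

open Classical in
/-- Summing a permutation-invariant weight `W` against a column of `signedShiftCount` amounts to
summing it over all admissible shifts of `l`: each of these is a rearrangement of exactly one
partition. -/
theorem sum_signedShiftCount_smul {R : Type*} [AddCommGroup R] [Module ℚ R] {d : ℕ}
    (W : (Fin d → ℕ) → R) (hW : ∀ β (σ : Equiv.Perm (Fin d)), W (β ∘ σ) = W β)
    (l : Nat.Partition d) :
    ∑ m, signedShiftCount d m l • W (rowSeq m) =
      ∑ σ : Equiv.Perm (Fin d), Equiv.Perm.sign σ •
        if ShiftAdmissible (rowSeq l) σ then W (shiftSeq (rowSeq l) σ) else 0 := by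
  simp only [signedShiftCount, Matrix.of_apply, Finset.sum_smul]
  rw [Finset.sum_comm]
  refine Finset.sum_congr rfl fun σ _ => ?_
  simp only [Units.smul_def, smul_assoc]
  rw [← Finset.smul_sum]
  congr 1
  by_cases h : ShiftAdmissible (rowSeq l) σ
  · rw [if_pos h, Finset.sum_eq_single (Nat.Partition.ofSums d _ (sum_shiftSeq l h))]
    · rw [if_pos ⟨h, rfl⟩, one_smul]
      obtain ⟨τ, hτ⟩ := exists_perm_rowSeq _ (sum_shiftSeq l h)
      rw [hτ, hW]
    · rintro m - hm
      rw [if_neg (fun ⟨_, h'⟩ => hm h'), zero_smul]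
    · simp
  · rw [if_neg h]
    refine Finset.sum_eq_zero fun m _ => ?_
    rw [if_neg (fun ⟨h', _⟩ => h h'), zero_smul]

theorem strictAnti_add_delta {n : ℕ} {l : Fin n → ℕ} (hl : Antitone l) :
    StrictAnti (fun i => l i + delta n i) := fun _ _ h =>
  add_lt_add_of_le_of_lt (hl h.le) (strictAnti_delta n h)

/-- The matrix of signed counts is inverse to the Kostka matrix, by comparison of the coefficients
of `x^(l + δ)` in `a_δ s_ν = a_{ν + δ}`. -/
theorem kostka_mul_signedShiftCount (d : ℕ) : kostka d * signedShiftCount d = 1 := by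
  classical
  ext ν l
  have hl := strictAnti_add_delta (antitone_rowSeq l)
  have hν := strictAnti_add_delta (antitone_rowSeq ν)
  have h1 := sum_signedShiftCount_smul (R := ℚ)
    (fun β => (schur (rowSeq ν)).coeff (expo β)) (fun β σ => coeff_schur_comp _ β σ) l
  have h2 := congrArg (MvPolynomial.coeff (expo fun i => rowSeq l i + delta d i))
    (alternant_delta_mul_schur (rowSeq ν))
  rw [coeff_alternant hν hl, alternant_eq_sum_monomial, Finset.sum_mul, MvPolynomial.coeff_sum,
    ← Equiv.sum_comp (Equiv.inv (Equiv.Perm (Fin d)))] at h2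
  rw [Matrix.mul_apply, Matrix.one_apply]
  have h3 : (fun i => rowSeq ν i + delta d i) = (fun i => rowSeq l i + delta d i) ↔ ν = l := by
    refine ⟨fun h => rowSeq_injective d (funext fun i => ?_), fun h => by rw [h]⟩
    exact Nat.add_right_cancel (congrFun h i)
  simp only [h3] at h2
  rw [← h2]
  refine Eq.trans ?_ (h1.trans ?_)
  · exact Finset.sum_congr rfl fun m _ => mul_comm _ _
  refine Finset.sum_congr rfl fun σ _ => ?_
  rw [smul_mul_assoc, Units.smul_def, Units.smul_def, MvPolynomial.coeff_smul,
    MvPolynomial.coeff_monomial_mul']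
  have hs : Equiv.Perm.sign (Equiv.inv (Equiv.Perm (Fin d)) σ) = Equiv.Perm.sign σ :=
    Equiv.Perm.sign_inv σ
  rw [hs, one_mul]
  congr 1
  refine if_congr Iff.rfl ?_ rfl
  congr 1
  ext i
  rfl

/-- The inverse Kostka numbers are signed counts of permutations. -/
theorem kostka_inv_eq (d : ℕ) : (kostka d)⁻¹ = signedShiftCount d :=
  Matrix.inv_eq_right_inv (kostka_mul_signedShiftCount d)

/-- The `n × n` matrix `(h_{l_i - i + j})`, with `h_k = 0` for `k < 0`. -/
def jacobiTrudi {R : Type*} [CommRing R] (h : ℕ → R) (l : ℕ → ℕ) (n : ℕ) :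
    Matrix (Fin n) (Fin n) R :=
  Matrix.of fun i j => if (i : ℕ) ≤ l i + j then h (l i + j - i) else 0

/-- The Jacobi–Trudi formula: the column of the inverse Kostka matrix at `l` consists of the
coefficients of `det (h_{l_i - i + j})` with respect to the products of the `h_k`, `k > 0`. -/
theorem sum_kostka_inv_smul_prod {R : Type*} [CommRing R] [Algebra ℚ R] {d : ℕ} (h : ℕ → R)
    (h0 : h 0 = 1) (l : Nat.Partition d) (l' : ℕ → ℕ) (hl : ∀ i : Fin d, rowSeq l i = l' i) :
    ∑ m, (kostka d)⁻¹ m l • (m.parts.map h).prod = (jacobiTrudi h l' d).det := by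
  classical
  rw [kostka_inv_eq, ← Matrix.det_transpose, Matrix.det_apply]
  simp only [← prod_rowSeq _ h h0]
  rw [sum_signedShiftCount_smul (fun β => ∏ i, h (β i))
    (fun β σ => Equiv.prod_comp σ (fun i => h (β i)))]
  refine Finset.sum_congr rfl fun σ _ => ?_
  congr 1
  have hle : ∀ i : Fin d, delta d (σ i) ≤ rowSeq l i + delta d i ↔ (i : ℕ) ≤ l' i + σ i := by
    intro i
    have := (σ i).isLt
    have := i.isLt
    rw [hl]
    simp only [delta]
    omega
  simp only [Matrix.transpose_apply, jacobiTrudi, Matrix.of_apply]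
  split_ifs with hσ
  · refine Finset.prod_congr rfl fun i _ => ?_
    rw [if_pos ((hle i).mp (hσ i))]
    congr 1
    have := (σ i).isLt
    have := i.isLt
    simp only [shiftSeq, delta, hl]
    omega
  · simp only [ShiftAdmissible, not_forall] at hσ
    obtain ⟨i, hi⟩ := hσ
    refine (Finset.prod_eq_zero (Finset.mem_univ i) ?_).symm
    rw [if_neg (fun h' => hi ((hle i).mpr h'))]

/-! ### Jacobi–Trudi determinants with `h_k = 0` for `k > 2` -/

section TwoVariables

variable {R : Type*} [CommRing R]

/-- The sequence `h_0 = 1, h_1 = a, h_2 = b, h_k = 0` for `k > 2`. -/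
def truncSeq (a b : R) : ℕ → R
  | 0 => 1
  | 1 => a
  | 2 => b
  | _ + 3 => 0

/-- The row lengths of the partition `2^p 1^q`. -/
def twoOneSeq (p q i : ℕ) : ℕ := if i < p then 2 else if i < p + q then 1 else 0

theorem jacobiTrudi_submatrix_succ (h : ℕ → R) (l : ℕ → ℕ) (n : ℕ) :
    (jacobiTrudi h l (n + 1)).submatrix Fin.succ Fin.succ =
      jacobiTrudi h (fun i => l (i + 1)) n := by
  ext i j
  simp only [jacobiTrudi, Matrix.submatrix_apply, Matrix.of_apply, Fin.val_succ]
  have h1 : ((i : ℕ) + 1 ≤ l (i + 1) + (j + 1)) ↔ (i : ℕ) ≤ l (i + 1) + j := by omega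
  have h2 : l ((i : ℕ) + 1) + (j + 1) - (i + 1) = l (i + 1) + j - i := by omega
  rw [h2]
  exact if_congr h1 rfl rfl

theorem det_jacobiTrudi_zero (a b : R) (n : ℕ) :
    (jacobiTrudi (truncSeq a b) (fun _ => 0) n).det = 1 := by
  rw [Matrix.det_of_isUpperTriangular]
  · refine Finset.prod_eq_one fun i _ => ?_
    simp [jacobiTrudi, truncSeq]
  · intro i j hij
    have : (j : ℕ) < i := hij
    simp only [jacobiTrudi, Matrix.of_apply]
    rw [if_neg (by omega)]

theorem det_jacobiTrudi_two (a b : R) (l : ℕ → ℕ) (hl : l 0 = 2) (n : ℕ) :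
    (jacobiTrudi (truncSeq a b) l (n + 1)).det =
      b * (jacobiTrudi (truncSeq a b) (fun i => l (i + 1)) n).det := by
  rw [Matrix.det_succ_row_zero, Finset.sum_eq_single 0]
  · rw [← jacobiTrudi_submatrix_succ]
    simp [jacobiTrudi, hl, truncSeq, Fin.succAbove_zero]
  · intro j _ hj
    obtain ⟨k, rfl⟩ := Fin.exists_succ_eq.mpr hj
    have : jacobiTrudi (truncSeq a b) l (n + 1) 0 k.succ = 0 := by
      simp [jacobiTrudi, hl, show 2 + ((k : ℕ) + 1) = k + 3 by omega, truncSeq]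
    rw [this]; simp
  · simp

theorem det_jacobiTrudi_one_zero (a b : R) (n : ℕ) :
    (jacobiTrudi (truncSeq a b) (twoOneSeq 0 1) (n + 1)).det = a := by
  rw [Matrix.det_succ_column_zero, Finset.sum_eq_single 0]
  · have : (fun i => twoOneSeq 0 1 (i + 1)) = fun _ => 0 := by
      ext i; simp [twoOneSeq]
    simp only [Fin.succAbove_zero, jacobiTrudi_submatrix_succ, this, det_jacobiTrudi_zero]
    simp [jacobiTrudi, twoOneSeq, truncSeq]
  · intro j _ hj
    obtain ⟨k, rfl⟩ := Fin.exists_succ_eq.mpr hj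
    simp [jacobiTrudi, twoOneSeq]
  · simp

theorem det_jacobiTrudi_one_one (a b : R) (l : ℕ → ℕ) (hl : l 0 = 1) (hl1 : l 1 = 1)
    (hl2 : ∀ i, l i ≤ 1) (n : ℕ) :
    (jacobiTrudi (truncSeq a b) l (n + 2)).det =
      a * (jacobiTrudi (truncSeq a b) (fun i => l (i + 1)) (n + 1)).det -
        b * (jacobiTrudi (truncSeq a b) (fun i => l (i + 2)) n).det := by
  rw [Matrix.det_succ_row_zero, Fin.sum_univ_succ, Fin.sum_univ_succ, Finset.sum_eq_zero]
  · -- the first column of this minor is `(h_0, 0, …, 0)`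
    have hminor : ((jacobiTrudi (truncSeq a b) l (n + 2)).submatrix Fin.succ
        (Fin.succAbove (Fin.succ 0))).det =
        (jacobiTrudi (truncSeq a b) (fun i => l (i + 2)) n).det := by
      rw [Matrix.det_succ_column_zero, Finset.sum_eq_single 0]
      · have : (((jacobiTrudi (truncSeq a b) l (n + 2)).submatrix Fin.succ
            (Fin.succAbove (Fin.succ 0))).submatrix (Fin.succAbove 0) Fin.succ) =
            jacobiTrudi (truncSeq a b) (fun i => l (i + 2)) n := by
          rw [← jacobiTrudi_submatrix_succ _ (fun i => l (i + 1)), ← jacobiTrudi_submatrix_succ,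
            Matrix.submatrix_submatrix, Matrix.submatrix_submatrix]
          congr 1
        rw [this]
        simp [jacobiTrudi, hl1, truncSeq]
      · intro j _ hj
        obtain ⟨k, rfl⟩ := Fin.exists_succ_eq.mpr hj
        have := hl2 (k + 1 + 1)
        simp only [Matrix.submatrix_apply, jacobiTrudi, Matrix.of_apply, Fin.val_succ]
        rw [if_neg (by simp; omega)]
        simp
      · simp
    rw [hminor, Fin.succAbove_zero, jacobiTrudi_submatrix_succ]
    simp [jacobiTrudi, hl, truncSeq]
    ring
  · intro j _
    have : jacobiTrudi (truncSeq a b) l (n + 2) 0 j.succ.succ = 0 := by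
      simp [jacobiTrudi, hl, show 1 + ((j : ℕ) + 1 + 1) = j + 3 by omega, truncSeq]
    rw [this]; simp

/-- The complete symmetric polynomial `h_n` in two variables, as a function of their elementary
symmetric polynomials `a` and `b`. -/
def completeTwo (a b : R) : ℕ → R
  | 0 => 1
  | 1 => a
  | n + 2 => a * completeTwo a b (n + 1) - b * completeTwo a b n

/-- Expansion along the first row gives the recursion `h_{q+2} = a h_{q+1} - b h_q`. -/
theorem det_jacobiTrudi_ones (a b : R) (q r : ℕ) :
    (jacobiTrudi (truncSeq a b) (twoOneSeq 0 q) (q + r)).det = completeTwo a b q := by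
  induction q using Nat.twoStepInduction with
  | zero =>
    have : twoOneSeq 0 0 = fun _ => 0 := by ext i; simp [twoOneSeq]
    rw [this, det_jacobiTrudi_zero, completeTwo]
  | one => rw [add_comm, det_jacobiTrudi_one_zero, completeTwo]
  | more q ih1 ih2 =>
    rw [show q + 2 + r = q + r + 2 by omega, det_jacobiTrudi_one_one, completeTwo, ← ih1, ← ih2,
      show q + 1 + r = q + r + 1 by omega]
    · congr 5
      · ext i; simp [twoOneSeq]
      · ext i; simp [twoOneSeq]
    · simp [twoOneSeq]
    · simp [twoOneSeq]
    · intro i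
      simp only [twoOneSeq]
      split_ifs <;> omega

theorem det_jacobiTrudi_twoOneSeq (a b : R) (p q r : ℕ) :
    (jacobiTrudi (truncSeq a b) (twoOneSeq p q) (p + q + r)).det = b ^ p * completeTwo a b q := by
  induction p with
  | zero => rw [zero_add, det_jacobiTrudi_ones, pow_zero, one_mul]
  | succ p ih =>
    rw [show p + 1 + q + r = p + q + r + 1 by omega, det_jacobiTrudi_two, pow_succ', mul_assoc,
      ← ih]
    · congr 3
      ext i; simp [twoOneSeq, show i + 1 < p + 1 + q ↔ i < p + q by omega]
    · simp [twoOneSeq]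

/-- The bialternant formula for `h_n(y, z)`. -/
theorem sub_mul_completeTwo (y z : R) (n : ℕ) :
    (y - z) * completeTwo (y + z) (y * z) n = y ^ (n + 1) - z ^ (n + 1) := by
  induction n using Nat.twoStepInduction with
  | zero => simp [completeTwo]
  | one => simp only [completeTwo]; ring
  | more n h1 h2 =>
    simp only [completeTwo]
    linear_combination (y + z) * h2 - y * z * h1

theorem map_completeTwo {S : Type*} [CommRing S] (f : R →+* S) (a b : R) (n : ℕ) :
    f (completeTwo a b n) = completeTwo (f a) (f b) n := by
  induction n using Nat.twoStepInduction with
  | zero => simp [completeTwo]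
  | one => simp [completeTwo]
  | more n h1 h2 => simp [completeTwo, h1, h2]

end TwoVariables

/-! ### Partitions with parts at most two -/

theorem rowSeq_eq_twoOneSeq {d p q : ℕ} (l : Nat.Partition d)
    (h : l.parts = Multiset.replicate p 2 + Multiset.replicate q 1) (i : Fin d) :
    rowSeq l i = twoOneSeq p q i := by
  have hs : l.parts.sort (fun a b => b ≤ a) = List.replicate p 2 ++ List.replicate q 1 := by
    refine List.Perm.eq_of_pairwise (le := fun a b => b ≤ a)
      (fun a b _ _ hab hba => le_antisymm hba hab) (l.parts.pairwise_sort _) ?_ ?_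
    · rw [List.pairwise_append]
      refine ⟨?_, ?_, ?_⟩
      · exact List.pairwise_replicate.mpr (Or.inr le_rfl)
      · exact List.pairwise_replicate.mpr (Or.inr le_rfl)
      · intro a ha b hb
        rw [List.eq_of_mem_replicate ha, List.eq_of_mem_replicate hb]
        norm_num
    · rw [← Multiset.coe_eq_coe, Multiset.sort_eq, h]
      rfl
  simp only [rowSeq, hs, twoOneSeq, List.getD_eq_getElem?_getD]
  by_cases h1 : (i : ℕ) < p
  · rw [List.getElem?_append_left (by simpa using h1)]
    simp [h1]
  · rw [List.getElem?_append_right (by simpa using h1)]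
    by_cases h2 : (i : ℕ) < p + q
    · simp [h1, h2, show (i : ℕ) - p < q by omega]
    · simp [h1, h2, show ¬ (i : ℕ) - p < q by omega]

namespace IntPartition

theorem size_ofSeq_two (l : Fin 2 → ℕ) : (ofSeq l).size = l 0 + l 1 := by
  have : ∀ s : Multiset ℕ, (s.filter (fun i => 0 < i)).sum = s.sum := by
    intro s
    induction s using Multiset.induction with
    | empty => simp
    | cons a s ih =>
      rcases Nat.eq_zero_or_pos a with rfl | h
      · simpa using ih
      · rw [Multiset.filter_cons_of_pos s (p := fun i => 0 < i) h, Multiset.sum_cons,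
          Multiset.sum_cons, ih]
  rw [size, ofSeq, this]
  simp

theorem parts_conj_ofSeq {l : Fin 2 → ℕ} (hl : Antitone l) :
    (ofSeq l).conj.parts = Multiset.replicate (l 1) 2 + Multiset.replicate (l 0 - l 1) 1 := by
  have hle : l 1 ≤ l 0 := hl (Fin.zero_le 1)
  have hcard : ∀ j, Multiset.card ((ofSeq l).parts.filter (fun i => j + 1 ≤ i)) =
      (if j < l 0 then 1 else 0) + (if j < l 1 then 1 else 0) := by
    intro j
    have h2 : (Finset.univ : Finset (Fin 2)).val.map l = l 0 ::ₘ {l 1} := rfl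
    simp only [ofSeq, h2, Multiset.filter_filter]
    rw [Multiset.filter_congr (q := fun i => j < i) (fun i _ => by omega), Multiset.filter_cons,
      Multiset.filter_singleton]
    split_ifs <;> simp
  simp only [conj, hcard, size_ofSeq_two]
  rw [show l 0 + l 1 = l 1 + ((l 0 - l 1) + l 1) by omega, Multiset.range_add,
    Multiset.range_add (l 0 - l 1)]
  simp only [Multiset.map_add, Multiset.filter_add, Multiset.map_map]
  have e1 : (Multiset.range (l 1)).map (fun j => (if j < l 0 then 1 else 0) +
      (if j < l 1 then 1 else 0)) = Multiset.replicate (l 1) 2 := by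
    rw [Multiset.map_congr (g := fun _ => 2) rfl, Multiset.map_const', Multiset.card_range]
    intro j hj
    rw [Multiset.mem_range] at hj
    rw [if_pos (by omega), if_pos hj]
  have e2 : (Multiset.range (l 0 - l 1)).map ((fun j => (if j < l 0 then 1 else 0) +
      (if j < l 1 then 1 else 0)) ∘ fun j => l 1 + j) = Multiset.replicate (l 0 - l 1) 1 := by
    rw [Multiset.map_congr (g := fun _ => 1) rfl, Multiset.map_const', Multiset.card_range]
    intro j hj
    rw [Multiset.mem_range] at hj
    rw [Function.comp_apply, if_pos (by omega), if_neg (by omega)]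
  have e3 : (Multiset.range (l 1)).map (((fun j => (if j < l 0 then 1 else 0) +
      (if j < l 1 then 1 else 0)) ∘ fun j => l 1 + j) ∘ fun j => l 0 - l 1 + j) =
      Multiset.replicate (l 1) 0 := by
    rw [Multiset.map_congr (g := fun _ => 0) rfl, Multiset.map_const', Multiset.card_range]
    intro j _
    rw [Function.comp_apply, Function.comp_apply, if_neg (by omega), if_neg (by omega)]
  rw [Function.comp_assoc] at e3
  rw [e1, e2, e3, Multiset.filter_eq_self.mpr, Multiset.filter_eq_self.mpr,
    Multiset.filter_eq_nil.mpr, add_zero]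
  · intro a ha; rw [Multiset.eq_of_mem_replicate ha]; exact lt_irrefl _
  · intro a ha; rw [Multiset.eq_of_mem_replicate ha]; exact one_pos
  · intro a ha; rw [Multiset.eq_of_mem_replicate ha]; exact two_pos

/-- The exponent of the monomial `e_1^b e_2^a` attached to the partition `2^a 1^b`. -/
def mult (ξ : IntPartition) : Fin 2 →₀ ℕ := expo ![ξ.parts.count 1, ξ.parts.count 2]

theorem eq_replicate_of_partsLE {s : Multiset ℕ} (hpos : ∀ i ∈ s, 0 < i) (hle : ∀ i ∈ s, i ≤ 2) :
    s = Multiset.replicate (s.count 1) 1 + Multiset.replicate (s.count 2) 2 := by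
  ext i
  rw [Multiset.count_add, Multiset.count_replicate, Multiset.count_replicate]
  by_cases h : i ∈ s
  · have := hpos i h
    have := hle i h
    interval_cases i <;> simp
  · rw [Multiset.count_eq_zero_of_notMem h]
    split_ifs with h1 h2 h2
    · omega
    · subst h1; simp [h]
    · subst h2; simp [h]
    · rfl

theorem size_eq_of_partsLE {ξ : IntPartition} (hξ : ξ.PartsLE 2) :
    ξ.size = mult ξ 0 + 2 * mult ξ 1 := by
  rw [size, eq_replicate_of_partsLE ξ.pos hξ]
  simp [mult, mul_comm]

theorem eq_of_mult_eq {ξ η : IntPartition} (hξ : ξ.PartsLE 2) (hη : η.PartsLE 2)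
    (h : mult ξ = mult η) : ξ = η := by
  have h0 : ξ.parts.count 1 = η.parts.count 1 := by simpa [mult] using DFunLike.congr_fun h 0
  have h1 : ξ.parts.count 2 = η.parts.count 2 := by simpa [mult] using DFunLike.congr_fun h 1
  ext1
  rw [eq_replicate_of_partsLE ξ.pos hξ, eq_replicate_of_partsLE η.pos hη, h0, h1]

/-- The partition `2^a 1^b` with exponent `(b, a)`. -/
def ofMult (m : Fin 2 →₀ ℕ) : IntPartition where
  parts := Multiset.replicate (m 0) 1 + Multiset.replicate (m 1) 2
  pos := by
    intro i hi
    rcases Multiset.mem_add.mp hi with h | h <;> rw [Multiset.eq_of_mem_replicate h] <;> norm_num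

theorem partsLE_ofMult (m : Fin 2 →₀ ℕ) : (ofMult m).PartsLE 2 := by
  intro i hi
  rcases Multiset.mem_add.mp hi with h | h <;> rw [Multiset.eq_of_mem_replicate h]
  norm_num

theorem mult_ofMult (m : Fin 2 →₀ ℕ) : mult (ofMult m) = m := by
  ext i
  fin_cases i <;> simp [mult, ofMult, Multiset.count_replicate]

theorem mult_union (ξ η : IntPartition) : mult (ξ.union η) = mult ξ + mult η := by
  ext i
  fin_cases i <;> simp [mult, union]

end IntPartition

/-! ### Inverse Kostka numbers as coefficients of Schur polynomials in two variables -/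

section Coefficients

open IntPartition MvPolynomial

/-- The products `e_1^b e_2^a` are distinct monomials, indexed by the partitions `2^a 1^b`; any part
larger than two makes the product vanish. -/
theorem coeff_prod_truncSeq {s : Multiset ℕ} (hpos : ∀ i ∈ s, 0 < i) {ξ : IntPartition}
    (hξ : ξ.PartsLE 2) :
    ((s.map (truncSeq (X 0) (X 1 : MvPolynomial (Fin 2) ℚ))).prod).coeff (mult ξ) =
      if s = ξ.parts then 1 else 0 := by
  by_cases hle : ∀ i ∈ s, i ≤ 2
  · have hm : (s.map (truncSeq (X 0) (X 1 : MvPolynomial (Fin 2) ℚ))).prod =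
        monomial (mult ⟨s, hpos⟩) 1 := by
      conv_lhs => rw [eq_replicate_of_partsLE hpos hle]
      rw [monomial_eq]
      simp [mult, truncSeq, Finsupp.prod_fintype]
    rw [hm, coeff_monomial]
    refine if_congr ⟨fun h => ?_, fun h => ?_⟩ rfl rfl
    · exact congrArg parts (eq_of_mult_eq (ξ := ⟨s, hpos⟩) hle hξ h)
    · congr 1
      exact IntPartition.ext h
  · rw [if_neg (fun h => hle (by rw [h]; exact hξ))]
    push Not at hle
    obtain ⟨i, hi, h2⟩ := hle
    obtain ⟨k, rfl⟩ : ∃ k, i = k + 3 := ⟨i - 3, by omega⟩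
    rw [Multiset.prod_eq_zero, coeff_zero]
    exact Multiset.mem_map.mpr ⟨_, hi, rfl⟩

/-- The inverse Kostka number `K⁻¹_{ξ l'}` is the coefficient of `e_ξ` in the Schur polynomial
`s_l` of two variables. -/
theorem kostkaInv_conj {ξ : IntPartition} (hξ : ξ.PartsLE 2) {l : Fin 2 → ℕ} (hl : Antitone l) :
    kostkaInv ξ (ofSeq l).conj =
      ((X 1 : MvPolynomial (Fin 2) ℚ) ^ l 1 * completeTwo (X 0) (X 1) (l 0 - l 1)).coeff
        (mult ξ) := by
  have hp := parts_conj_ofSeq hl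
  have hd : (ofSeq l).conj.size = l 1 + (l 0 - l 1) + l 1 := by
    rw [size, hp]; simp; omega
  have h := sum_kostka_inv_smul_prod (truncSeq (X 0) (X 1 : MvPolynomial (Fin 2) ℚ)) rfl
    (ofSeq l).conj.toNatPartition _ (rowSeq_eq_twoOneSeq _ hp)
  have hdet : (jacobiTrudi (truncSeq (X 0) (X 1 : MvPolynomial (Fin 2) ℚ))
      (twoOneSeq (l 1) (l 0 - l 1)) (ofSeq l).conj.size).det =
      X 1 ^ l 1 * completeTwo (X 0) (X 1) (l 0 - l 1) := by
    rw [hd, det_jacobiTrudi_twoOneSeq]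
  rw [hdet] at h
  rw [← h, coeff_sum]
  simp only [coeff_smul]
  rw [Finset.sum_congr rfl fun m _ => by rw [coeff_prod_truncSeq (fun i hi => m.parts_pos hi) hξ]]
  unfold kostkaInv
  split_ifs with hs
  · rw [Finset.sum_eq_single ⟨ξ.parts, fun {i} hi => ξ.pos i hi, hs⟩]
    · simp
    · intro m _ hm
      rw [if_neg (fun h' => hm (Nat.Partition.ext h')), smul_zero]
    · simp
  · refine (Finset.sum_eq_zero fun m _ => ?_).symm
    rw [if_neg, smul_zero]
    intro h'
    exact hs (by rw [size, ← h', m.parts_sum])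

/-- The quotient `(y^i z^j - y^j z^i) / (y - z)`, a Schur polynomial in `y`, `z` up to sign, written
as a polynomial in `X 0 = y + z` and `X 1 = y z`. -/
def signedSchur (i j : ℕ) : MvPolynomial (Fin 2) ℚ :=
  if j < i then X 1 ^ j * completeTwo (X 0) (X 1) (i - 1 - j)
  else if i < j then -(X 1 ^ i * completeTwo (X 0) (X 1) (j - 1 - i))
  else 0

/-- The bialternant formula for two variables. -/
theorem sub_mul_map_signedSchur {R : Type*} [CommRing R] (f : MvPolynomial (Fin 2) ℚ →+* R)
    {y z : R} (h0 : f (X 0) = y + z) (h1 : f (X 1) = y * z) (i j : ℕ) :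
    (y - z) * f (signedSchur i j) = y ^ i * z ^ j - y ^ j * z ^ i := by
  unfold signedSchur
  split_ifs with h h'
  · obtain ⟨k, rfl⟩ : ∃ k, i = j + k + 1 := ⟨i - j - 1, by omega⟩
    rw [map_mul, map_pow, map_completeTwo, h0, h1, show j + k + 1 - 1 - j = k by omega]
    linear_combination (y * z) ^ j * sub_mul_completeTwo y z k
  · obtain ⟨k, rfl⟩ : ∃ k, j = i + k + 1 := ⟨j - i - 1, by omega⟩
    rw [map_neg, map_mul, map_pow, map_completeTwo, h0, h1, show i + k + 1 - 1 - i = k by omega]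
    linear_combination -(y * z) ^ i * sub_mul_completeTwo y z k
  · obtain rfl : i = j := by omega
    simp

theorem signedSchur_self (i : ℕ) : signedSchur i i = 0 := by simp [signedSchur]

theorem kostkaInv_eq_coeff_signedSchur {ξ : IntPartition} (hξ : ξ.PartsLE 2) {l : Fin 2 → ℕ}
    (hl : Antitone l) :
    kostkaInv ξ (ofSeq l).conj = (signedSchur (l 0 + 1) (l 1)).coeff (mult ξ) := by
  have hle : l 1 ≤ l 0 := hl (Fin.zero_le 1)
  rw [kostkaInv_conj hξ hl, signedSchur, if_pos (by omega), Nat.add_sub_cancel]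

/-- The sign of `τ_u` is absorbed by the antisymmetry of `signedSchur`. -/
theorem sgnTau_mul_kostkaInv {ξ : IntPartition} (hξ : ξ.PartsLE 2) (u : A₂) :
    sgnTau u * kostkaInv ξ (straighten u).conj =
      (signedSchur (u.1 0) (u.1 1)).coeff (mult ξ) := by
  have hu := tau_spec u
  rw [straighten, kostkaInv_eq_coeff_signedSchur hξ]
  · simp only [delta, Fin.val_zero, Fin.val_one]
    by_cases h : u.1 1 < u.1 0
    · simp [sgnTau, tau, h, Nat.sub_add_cancel (show 1 ≤ u.1 0 by omega)]
    · have hne := u.2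
      have h' : u.1 0 < u.1 1 := by omega
      have e1 : signedSchur (u.1 1) (u.1 0) = -signedSchur (u.1 0) (u.1 1) := by
        simp [signedSchur, h, h']
      simp [sgnTau, tau, h, Nat.sub_add_cancel (show 1 ≤ u.1 1 by omega), e1]
  · rw [Fin.antitone_iff_succ_le]
    intro i
    fin_cases i
    simp only [delta]
    simp
    omega

/-- `signedSchur i j` is homogeneous of degree `i + j - 1`, where `X 0` and `X 1` have the degrees
`1` and `2`. -/
theorem degree_of_coeff_signedSchur_ne_zero {m : Fin 2 →₀ ℕ} {i j : ℕ}
    (h : (signedSchur i j).coeff m ≠ 0) : i + j = m 0 + 2 * m 1 + 1 := by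
  wlog hij : j < i generalizing i j
  · by_cases hji : i < j
    · rw [add_comm i j]
      refine this ?_ hji
      simpa [signedSchur, hij, hji] using h
    · obtain rfl : i = j := by omega
      simp [signedSchur_self] at h
  have hl : Antitone ![i - 1, j] := by
    rw [Fin.antitone_iff_succ_le]
    intro k
    fin_cases k
    simp
    omega
  have h1 := kostkaInv_eq_coeff_signedSchur (partsLE_ofMult m) hl
  rw [mult_ofMult] at h1
  simp only [Matrix.cons_val_zero, Matrix.cons_val_one, Nat.sub_add_cancel (show 1 ≤ i by omega)]
    at h1
  rw [← h1, kostkaInv] at h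
  have hs : (ofMult m).size = (ofSeq ![i - 1, j]).conj.size := by
    by_contra hs
    rw [dif_neg hs] at h
    exact h rfl
  rw [size_eq_of_partsLE (partsLE_ofMult m), mult_ofMult, size, parts_conj_ofSeq hl] at hs
  simp at hs
  omega

/-- Since `e_{η ∪ ζ} = e_η e_ζ`, the convolution over `η ∪ ζ = ξ` is the coefficient of `e_ξ` in a
product. -/
theorem sgnTau_mul_kostkaConv {ξ : IntPartition} (hξ : ξ.PartsLE 2) (u v : A₂) :
    sgnTau u * sgnTau v * kostkaConv ξ (straighten u) (straighten v) =
      (signedSchur (u.1 0) (u.1 1) * signedSchur (v.1 0) (v.1 1)).coeff (mult ξ) := by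
  rw [kostkaConv, finsum_mem_eq_finite_toFinset_sum _ (finite_unionPairs 2 ξ), Finset.mul_sum,
    coeff_mul]
  refine Finset.sum_bij' (fun p _ => (mult p.1, mult p.2)) (fun p _ => (ofMult p.1, ofMult p.2))
    ?_ ?_ ?_ ?_ ?_
  · intro p hp
    obtain ⟨-, -, h⟩ := (Set.Finite.mem_toFinset _).mp hp
    rw [Finset.HasAntidiagonal.mem_antidiagonal, ← mult_union, h]
  · intro p hp
    rw [Finset.HasAntidiagonal.mem_antidiagonal] at hp
    refine (Set.Finite.mem_toFinset _).mpr ⟨partsLE_ofMult _, partsLE_ofMult _, ?_⟩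
    refine eq_of_mult_eq ?_ hξ (by rw [mult_union, mult_ofMult, mult_ofMult, hp])
    intro i hi
    exact (Multiset.mem_add.mp hi).elim (partsLE_ofMult _ i) (partsLE_ofMult _ i)
  · intro p hp
    obtain ⟨h1, h2, -⟩ := (Set.Finite.mem_toFinset _).mp hp
    exact Prod.ext (eq_of_mult_eq (partsLE_ofMult _) h1 (mult_ofMult _))
      (eq_of_mult_eq (partsLE_ofMult _) h2 (mult_ofMult _))
  · intro p _
    simp [mult_ofMult]
  · intro p hp
    obtain ⟨h1, h2, -⟩ := (Set.Finite.mem_toFinset _).mp hp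
    rw [← sgnTau_mul_kostkaInv h1, ← sgnTau_mul_kostkaInv h2]
    ring

end Coefficients

/-! ### Even and odd parts of a power series -/

section PowerSeriesIdentities

open PowerSeries

section EvenOdd
variable {R : Type*} [CommRing R]

/-- The series `∑ f_{2n} t^n`. -/
def evenPart (f : R⟦X⟧) : R⟦X⟧ := mk fun n => coeff (2 * n) f

/-- The series `∑ f_{2n+1} t^n`. -/
def oddPart (f : R⟦X⟧) : R⟦X⟧ := mk fun n => coeff (2 * n + 1) f

theorem evenPart_add_X_mul (a b : R⟦X⟧) :
    evenPart (expand 2 two_ne_zero a + X * expand 2 two_ne_zero b) = a := by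
  ext n
  rw [evenPart, coeff_mk, map_add, coeff_expand_mul]
  cases n with
  | zero => simp
  | succ n =>
    rw [show 2 * (n + 1) = 2 * n + 1 + 1 by ring, coeff_succ_X_mul, coeff_expand_of_not_dvd,
      add_zero]
    omega

theorem oddPart_add_X_mul (a b : R⟦X⟧) :
    oddPart (expand 2 two_ne_zero a + X * expand 2 two_ne_zero b) = b := by
  ext n
  rw [oddPart, coeff_mk, map_add, coeff_succ_X_mul, coeff_expand_mul, coeff_expand_of_not_dvd,
    zero_add]
  omega

theorem eq_evenPart_add (f : R⟦X⟧) :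
    f = expand 2 two_ne_zero (evenPart f) + X * expand 2 two_ne_zero (oddPart f) := by
  ext n
  rcases Nat.even_or_odd' n with ⟨k, rfl | rfl⟩
  · exact ((coeff_mk _ _).symm.trans
      (congrArg (coeff k) (evenPart_add_X_mul (evenPart f) (oddPart f))) |>.trans
      (coeff_mk _ _)).symm
  · exact ((coeff_mk _ _).symm.trans
      (congrArg (coeff k) (oddPart_add_X_mul (evenPart f) (oddPart f))) |>.trans
      (coeff_mk _ _)).symm

theorem mul_eq_expand (f g : R⟦X⟧) : f * g =
    expand 2 two_ne_zero (evenPart f * evenPart g + X * (oddPart f * oddPart g)) +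
      X * expand 2 two_ne_zero (evenPart f * oddPart g + oddPart f * evenPart g) := by
  conv_lhs => rw [eq_evenPart_add f, eq_evenPart_add g]
  simp only [map_add, map_mul, expand_X]
  ring

theorem evenPart_mul (f g : R⟦X⟧) :
    evenPart (f * g) = evenPart f * evenPart g + X * (oddPart f * oddPart g) := by
  rw [mul_eq_expand, evenPart_add_X_mul]

theorem oddPart_mul (f g : R⟦X⟧) :
    oddPart (f * g) = evenPart f * oddPart g + oddPart f * evenPart g := by
  rw [mul_eq_expand, oddPart_add_X_mul]

theorem evenPart_rescale (f : R⟦X⟧) : evenPart (rescale (-1) f) = evenPart f := by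
  ext n; simp [evenPart]

theorem oddPart_rescale (f : R⟦X⟧) : oddPart (rescale (-1) f) = -oddPart f := by
  ext n; simp [oddPart, pow_succ]

end EvenOdd

/-! ### The series of the `q_r` and the polynomials `Q_{(r,s)}` -/

section QSeries
variable {ι R : Type*} [Fintype ι] [CommRing R] (x : ι → R)

theorem one_sub_mul_mk_pow (a : R) : (1 - C a * X) * mk (fun k => a ^ k) = 1 := by
  ext n
  rw [sub_mul, one_mul, mul_assoc, map_sub, coeff_C_mul]
  cases n with
  | zero => simp
  | succ n => simp [coeff_succ_X_mul, pow_succ', coeff_one]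

/-- `q(t) q(-t) = 1`. -/
theorem qSeries_mul_rescale : qSeries x * rescale (-1) (qSeries x) = 1 := by
  rw [qSeries, map_prod, ← Finset.prod_mul_distrib]
  refine Finset.prod_eq_one fun i _ => ?_
  have h1 := one_sub_mul_mk_pow (x i)
  have h2 : rescale (-1) (mk fun k => x i ^ k) = mk fun k => (-x i) ^ k := by
    ext n; simp [← mul_pow]
  have h3 := one_sub_mul_mk_pow (-x i)
  have h4 : rescale (-1) (C (x i)) = C (x i) := by
    ext n
    rw [coeff_rescale, coeff_C]
    split_ifs with h
    · simp [h]
    · simp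
  rw [map_mul, h2, map_add, map_mul, map_one, rescale_neg_one_X, h4]
  rw [map_neg] at h3
  linear_combination
    ((1 + C (x i) * X) * (mk fun k => (-x i) ^ k)) * h1 + h3

theorem qSeries_sum_elim : qSeries (Sum.elim x x) = qSeries x * qSeries x := by
  simp [qSeries, Fintype.prod_sum_type]

/-- The even part of `q(t) q(-t) = 1`: if `q(t) = A(t²) + t B(t²)`, then `A(t)² - t B(t)² = 1`. -/
theorem evenPart_qSeries_sq :
    evenPart (qSeries x) ^ 2 - X * oddPart (qSeries x) ^ 2 = 1 := by
  have h := congrArg evenPart (qSeries_mul_rescale x)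
  rw [evenPart_mul, evenPart_rescale, oddPart_rescale] at h
  have h1 : evenPart (1 : R⟦X⟧) = 1 := by
    ext n; simp [evenPart, coeff_one]
  rw [h1] at h
  linear_combination h

theorem map_qSeries {S : Type*} [CommRing S] (f : R →+* S) :
    PowerSeries.map f (qSeries x) = qSeries (f ∘ x) := by
  simp only [qSeries, map_prod, map_mul, map_add, map_one, map_C, map_X]
  refine Finset.prod_congr rfl fun i _ => ?_
  congr 1
  ext n; simp

theorem map_q {S : Type*} [CommRing S] (f : R →+* S) (r : ℤ) : f (q x r) = q (f ∘ x) r := by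
  unfold q
  rw [apply_ite f, map_zero, ← map_qSeries, coeff_map]

theorem map_Q₂ {S : Type*} [CommRing S] (f : R →+* S) (r s : ℕ) :
    f (Q₂ x r s) = Q₂ (f ∘ x) r s := by
  unfold Q₂
  rw [apply_ite f]
  simp only [map_zero, map_add, map_mul, map_sum, map_pow, map_neg, map_one, map_q, map_ofNat]

theorem q_natCast (n : ℕ) : q x n = coeff n (qSeries x) := by simp [q]

theorem coeff_zero_qSeries : coeff 0 (qSeries x) = 1 := by
  rw [coeff_zero_eq_constantCoeff, qSeries, map_prod]
  exact Finset.prod_eq_one fun i _ => by simp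

theorem Q₂_eq {r s : ℕ} (h : ¬(r = 0 ∧ s = 0)) :
    Q₂ x r s = coeff r (qSeries x) * coeff s (qSeries x) +
      2 * ∑ i ∈ Finset.range s,
        (-1) ^ (i + 1) * coeff (r + (i + 1)) (qSeries x) * coeff (s - (i + 1)) (qSeries x) := by
  rw [Q₂, if_neg h, q_natCast, q_natCast]
  congr 2
  rw [show Finset.Icc 1 s = Finset.Ico 1 (s + 1) from rfl, Finset.sum_Ico_eq_sum_range]
  refine Finset.sum_congr rfl fun i hi => ?_
  have hi := Finset.mem_range.mp hi
  rw [← q_natCast, ← q_natCast, add_comm 1 i, Nat.cast_sub (by omega)]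
  push_cast
  rfl

theorem Q₂_zero_right {r : ℕ} (h : r ≠ 0) : Q₂ x r 0 = coeff r (qSeries x) := by
  rw [Q₂_eq x (by simp [h]), coeff_zero_qSeries]; simp

theorem Q₂_one_right (r : ℕ) : Q₂ x r 1 =
    coeff r (qSeries x) * coeff 1 (qSeries x) - 2 * coeff (r + 1) (qSeries x) := by
  rw [Q₂_eq x (by simp)]; simp [coeff_zero_qSeries]; ring

/-- The coefficients of the identity `(s + t) ∑ Q_{(m,n)} s^m t^n = (s - t) (q(s) q(t) - 1)`. -/
theorem Q₂_add_Q₂ (r s : ℕ) : Q₂ x r (s + 1) + Q₂ x (r + 1) s =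
    coeff r (qSeries x) * coeff (s + 1) (qSeries x) -
      coeff (r + 1) (qSeries x) * coeff s (qSeries x) := by
  rw [Q₂_eq x (by simp), Q₂_eq x (by simp), Finset.sum_range_succ']
  have : ∑ i ∈ Finset.range s, (-1) ^ (i + 1 + 1) * coeff (r + (i + 1 + 1)) (qSeries x) *
        coeff (s + 1 - (i + 1 + 1)) (qSeries x) = -∑ i ∈ Finset.range s,
        (-1) ^ (i + 1) * coeff (r + 1 + (i + 1)) (qSeries x) *
          coeff (s - (i + 1)) (qSeries x) := by
    rw [← Finset.sum_neg_distrib]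
    refine Finset.sum_congr rfl fun i _ => ?_
    rw [show r + (i + 1 + 1) = r + 1 + (i + 1) by omega,
      show s + 1 - (i + 1 + 1) = s - (i + 1) by omega]
    ring
  rw [this]
  simp only [zero_add, pow_one, Nat.add_sub_cancel]
  ring

/-- A recursion between values of `Q` whose indices have the same parities. -/
theorem Q₂_sub_Q₂ (r s : ℕ) : Q₂ x r (s + 2) - Q₂ x (r + 2) s =
    coeff r (qSeries x) * coeff (s + 2) (qSeries x) -
      2 * (coeff (r + 1) (qSeries x) * coeff (s + 1) (qSeries x)) +
      coeff (r + 2) (qSeries x) * coeff s (qSeries x) := by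
  linear_combination Q₂_add_Q₂ x r (s + 1) - Q₂_add_Q₂ x (r + 1) s

/-- For `r > 0` this is the coefficient of `t^r` in `q(t) q(-t) = 1`. -/
theorem Q₂_zero_left {r : ℕ} (h : r ≠ 0) :
    Q₂ x 0 r = -coeff r (qSeries x) := by
  have h1 := congrArg (coeff r) (qSeries_mul_rescale x)
  rw [mul_comm, coeff_mul, Finset.Nat.sum_antidiagonal_eq_sum_range_succ
    (fun i j => coeff i (rescale (-1) (qSeries x)) * coeff j (qSeries x)), coeff_one, if_neg h,
    Finset.sum_range_succ'] at h1
  rw [Q₂_eq x (by simp [h]), coeff_zero_qSeries]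
  simp only [coeff_rescale, Nat.sub_zero, coeff_zero_qSeries, pow_zero] at h1
  simp only [zero_add]
  linear_combination 2 * h1

/-- At `(0, 0)` this holds because of the convention `Q_{(0,0)} = 0`. -/
theorem Q₂_antisymm (r s : ℕ) : Q₂ x r s = -Q₂ x s r := by
  induction s generalizing r with
  | zero =>
    by_cases h : r = 0
    · subst h; simp [Q₂]
    · rw [Q₂_zero_right x h, Q₂_zero_left x h, neg_neg]
  | succ s ih =>
    linear_combination Q₂_add_Q₂ x r s + Q₂_add_Q₂ x s r - ih (r + 1)

/-! ### Bivariate generating series -/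

/-- The series `∑ w_{ij} y^i z^j`, graded by a formal variable of degree `i + j`. -/
def biSeries (w : ℕ → ℕ → R) (y z : R) : R⟦X⟧ :=
  mk fun n => ∑ p ∈ Finset.HasAntidiagonal.antidiagonal n, w p.1 p.2 * (y ^ p.1 * z ^ p.2)

theorem biSeries_mul (a b : ℕ → R) (y z : R) :
    biSeries (fun i j => a i * b j) y z = rescale y (mk a) * rescale z (mk b) := by
  ext n
  rw [biSeries, coeff_mk, coeff_mul]
  refine Finset.sum_congr rfl fun p _ => ?_
  simp only [coeff_rescale, coeff_mk]
  ring

theorem biSeries_add (w w' : ℕ → ℕ → R) (y z : R) :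
    biSeries (fun i j => w i j + w' i j) y z = biSeries w y z + biSeries w' y z := by
  ext n
  simp only [biSeries, coeff_mk, map_add, ← Finset.sum_add_distrib, add_mul]

theorem biSeries_smul (c : R) (w : ℕ → ℕ → R) (y z : R) :
    biSeries (fun i j => c * w i j) y z = C c * biSeries w y z := by
  ext n
  simp only [biSeries, coeff_mk, coeff_C_mul, Finset.mul_sum, mul_assoc]

theorem biSeries_shift_left (w : ℕ → ℕ → R) (y z : R) :
    biSeries w y z = rescale z (mk (w 0)) + C y * X * biSeries (fun i j => w (i + 1) j) y z := by
  ext n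
  rw [map_add, mul_assoc, coeff_C_mul]
  cases n with
  | zero => simp [biSeries]
  | succ n =>
    rw [coeff_succ_X_mul, biSeries, biSeries, coeff_mk, coeff_mk,
      Finset.Nat.sum_antidiagonal_succ, Finset.mul_sum]
    simp only [coeff_rescale, coeff_mk]
    congr 1
    · ring
    · exact Finset.sum_congr rfl fun p _ => by ring

theorem biSeries_swap (w : ℕ → ℕ → R) (y z : R) :
    biSeries w y z = biSeries (fun i j => w j i) z y := by
  ext n
  rw [biSeries, biSeries, coeff_mk, coeff_mk, ← Finset.Nat.sum_antidiagonal_swap]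
  exact Finset.sum_congr rfl fun p _ => by simp only [Prod.fst_swap, Prod.snd_swap]; ring

theorem biSeries_shift_right (w : ℕ → ℕ → R) (y z : R) :
    biSeries w y z =
      rescale y (mk fun i => w i 0) + C z * X * biSeries (fun i j => w i (j + 1)) y z := by
  rw [biSeries_swap, biSeries_shift_left, ← biSeries_swap (fun i j => w i (j + 1))]

/-! ### The quadratic identities -/

/-- Doubling the variables squares `q(t)`; here `A² + t B²` is rewritten by `A² - t B² = 1`. -/
theorem evenPart_qSeries_double :
    evenPart (qSeries (Sum.elim x x)) = 1 + 2 * X * oddPart (qSeries x) ^ 2 := by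
  rw [qSeries_sum_elim, evenPart_mul]
  linear_combination evenPart_qSeries_sq x

theorem oddPart_qSeries_double :
    oddPart (qSeries (Sum.elim x x)) = 2 * (evenPart (qSeries x) * oddPart (qSeries x)) := by
  rw [qSeries_sum_elim, oddPart_mul]
  ring

theorem shift_evenPart_qSeries_double :
    (mk fun n => coeff (2 * n + 2) (qSeries (Sum.elim x x))) = 2 * oddPart (qSeries x) ^ 2 := by
  have h := evenPart_qSeries_double x
  ext n
  have h1 := congrArg (coeff (n + 1)) h
  rw [evenPart, coeff_mk, map_add, coeff_one, if_neg (by omega), zero_add,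
    show 2 * X * oddPart (qSeries x) ^ 2 = X * (2 * oddPart (qSeries x) ^ 2) by ring,
    coeff_succ_X_mul] at h1
  rw [coeff_mk, ← h1]
  rfl

theorem rescale_evenPart_qSeries_sq (y : R) :
    rescale y (evenPart (qSeries x)) ^ 2 -
      C y * X * rescale y (oddPart (qSeries x)) ^ 2 = 1 := by
  have := congrArg (rescale y) (evenPart_qSeries_sq x)
  simpa only [map_sub, map_mul, map_pow, map_one, rescale_X] using this

/-- With `q(t) = A(t²) + t B(t²)`, the product of `y - z` and the generating series of the
`Q_{(2i+2,2j+2)}(x,x)` is four times the square of `A(y) B(z) - A(z) B(y)`. The factor `X` keeps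
track of the degree of `y - z`. -/
theorem X_mul_biSeries_even (y z : R) :
    C (y - z) * X * biSeries (fun i j => Q₂ (Sum.elim x x) (2 * i + 2) (2 * j + 2)) y z =
      4 * (rescale y (evenPart (qSeries x)) * rescale z (oddPart (qSeries x)) -
        rescale z (evenPart (qSeries x)) * rescale y (oddPart (qSeries x))) ^ 2 := by
  set xx := Sum.elim x x with hxx
  have hl := biSeries_shift_left (fun i j => Q₂ xx (2 * i) (2 * j + 2)) y z
  have hr := biSeries_shift_right (fun i j => Q₂ xx (2 * i + 2) (2 * j)) y z
  -- the two shifted series differ by the recursion for `Q`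
  have hrec : biSeries (fun i j => Q₂ xx (2 * i) (2 * j + 2)) y z =
      biSeries (fun i j => Q₂ xx (2 * i + 2) (2 * j)) y z +
      (rescale y (evenPart (qSeries xx)) *
          rescale z (mk fun n => coeff (2 * n + 2) (qSeries xx)) +
        C (-2) * (rescale y (oddPart (qSeries xx)) * rescale z (oddPart (qSeries xx))) +
        rescale y (mk fun n => coeff (2 * n + 2) (qSeries xx)) *
          rescale z (evenPart (qSeries xx))) := by
    simp only [evenPart, oddPart, ← biSeries_mul, ← biSeries_smul, ← biSeries_add]
    congr 1
    ext i j
    linear_combination Q₂_sub_Q₂ xx (2 * i) (2 * j)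
  have e1 : (mk fun j => Q₂ xx (2 * 0) (2 * j + 2)) =
      -(mk fun n => coeff (2 * n + 2) (qSeries xx)) := by
    ext j
    rw [map_neg, coeff_mk, coeff_mk, mul_zero, Q₂_zero_left xx (by omega)]
  have e2 : (mk fun i => Q₂ xx (2 * i + 2) (2 * 0)) =
      mk fun n => coeff (2 * n + 2) (qSeries xx) := by
    ext j
    rw [coeff_mk, coeff_mk, mul_zero, Q₂_zero_right xx (by omega)]
  rw [e1, map_neg] at hl
  rw [e2] at hr
  rw [hl, hr, evenPart_qSeries_double, oddPart_qSeries_double,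
    shift_evenPart_qSeries_double] at hrec
  simp only [map_sub, map_mul, map_pow, map_add, map_one, map_ofNat, map_neg, rescale_X] at hrec ⊢
  have hy := rescale_evenPart_qSeries_sq x y
  have hz := rescale_evenPart_qSeries_sq x z
  set A := rescale y (evenPart (qSeries x))
  set A' := rescale z (evenPart (qSeries x))
  set B := rescale y (oddPart (qSeries x))
  set B' := rescale z (oddPart (qSeries x))
  linear_combination hrec - 4 * B' ^ 2 * hy - 4 * B ^ 2 * hz

/-- With `q(t) = A(t²) + t B(t²)`, the product of `y - z` and the generating series of the
`Q_{(2i+1,2j+1)}(x,x)` is four times the product of `y B(y) A(z) - z B(z) A(y)` and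
`A(y) B(z) - A(z) B(y)`. The factors `X` keep track of the degrees of `y` and `z`. -/
theorem X_mul_biSeries_odd (y z : R) :
    C (y - z) * X * biSeries (fun i j => Q₂ (Sum.elim x x) (2 * i + 1) (2 * j + 1)) y z =
      4 * ((C y * X * rescale y (oddPart (qSeries x)) * rescale z (evenPart (qSeries x)) -
          C z * X * rescale z (oddPart (qSeries x)) * rescale y (evenPart (qSeries x))) *
        (rescale y (evenPart (qSeries x)) * rescale z (oddPart (qSeries x)) -
          rescale z (evenPart (qSeries x)) * rescale y (oddPart (qSeries x)))) := by
  set xx := Sum.elim x x with hxx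
  have hl := biSeries_shift_left
    (fun i j => if i = 0 then 0 else Q₂ xx (2 * i - 1) (2 * j + 1)) y z
  have hr := biSeries_shift_right
    (fun i j => if j = 0 then 0 else Q₂ xx (2 * i + 1) (2 * j - 1)) y z
  have hodd : (mk fun n => if n = 0 then 0 else coeff (2 * n - 1) (qSeries xx)) =
      X * oddPart (qSeries xx) := by
    ext n
    cases n with
    | zero => simp
    | succ n =>
      rw [coeff_mk, coeff_succ_X_mul, oddPart, coeff_mk, if_neg (by omega)]
      rfl
  have hone : (mk fun n => if n = 0 then 1 else 0 : R⟦X⟧) = 1 := by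
    ext n; simp [coeff_one]
  -- the last term corrects the recursion at `i = j = 0`, where it would give `-2`
  have hrec : biSeries (fun i j => if i = 0 then 0 else Q₂ xx (2 * i - 1) (2 * j + 1)) y z =
      biSeries (fun i j => if j = 0 then 0 else Q₂ xx (2 * i + 1) (2 * j - 1)) y z +
      (rescale y (mk fun n => if n = 0 then 0 else coeff (2 * n - 1) (qSeries xx)) *
          rescale z (oddPart (qSeries xx)) +
        C (-2) * (rescale y (evenPart (qSeries xx)) * rescale z (evenPart (qSeries xx))) +
        rescale y (oddPart (qSeries xx)) *
          rescale z (mk fun n => if n = 0 then 0 else coeff (2 * n - 1) (qSeries xx)) +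
        C 2 * (rescale y (mk fun n => if n = 0 then 1 else 0) *
          rescale z (mk fun n => if n = 0 then 1 else 0))) := by
    simp only [evenPart, oddPart, ← biSeries_mul, ← biSeries_smul, ← biSeries_add]
    congr 1
    ext i j
    rcases i with _ | i <;> rcases j with _ | j
    · simp [coeff_zero_qSeries]
    · have h := Q₂_one_right xx (2 * j + 1)
      have h' := Q₂_antisymm xx 1 (2 * j + 1)
      simp [coeff_zero_qSeries, mul_add]
      linear_combination h - h'
    · have h := Q₂_one_right xx (2 * i + 1)
      simp [coeff_zero_qSeries, mul_add]
      linear_combination h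
    · have h := Q₂_sub_Q₂ xx (2 * i + 1) (2 * j + 1)
      simp [mul_add]
      linear_combination h
  simp only [if_true, Nat.add_eq_zero_iff, one_ne_zero, and_false, if_false] at hl hr
  have e0 : (mk fun _ => 0 : R⟦X⟧) = 0 := rfl
  rw [e0, map_zero, zero_add] at hl hr
  rw [hl, hr, hodd, hone, evenPart_qSeries_double, oddPart_qSeries_double] at hrec
  simp only [map_sub, map_mul, map_pow, map_add, map_one, map_ofNat, map_neg, rescale_X] at hrec ⊢
  have hy := rescale_evenPart_qSeries_sq x y
  have hz := rescale_evenPart_qSeries_sq x z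
  have e3 : ∀ i, 2 * (i + 1) - 1 = 2 * i + 1 := fun i => by omega
  simp only [e3] at hrec
  set A := rescale y (evenPart (qSeries x))
  set A' := rescale z (evenPart (qSeries x))
  set B := rescale y (oddPart (qSeries x))
  set B' := rescale z (oddPart (qSeries x))
  linear_combination hrec + 4 * C y * X * B ^ 2 * hz + 4 * C z * X * B' ^ 2 * hy

end QSeries

end PowerSeriesIdentities

/-! ### The sums as coefficients of series of Schur polynomials -/

/-- A `finsum` along an injection `e` is a finite sum, when the summand is supported in a finite set
and vanishes off the range of `e`. -/
theorem finsum_comp_eq_sum {ι κ M : Type*} [AddCommMonoid M] {e : ι → κ}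
    (he : Function.Injective e) {t : κ → M} (F : Finset κ) (hF : ∀ k, t k ≠ 0 → k ∈ F)
    (hr : ∀ k, k ∉ Set.range e → t k = 0) :
    (Function.support fun i => t (e i)).Finite ∧ ∑ᶠ i, t (e i) = ∑ k ∈ F, t k := by
  have hsub : (Function.support fun i => t (e i)) ⊆ (F.preimage e he.injOn : Finset ι) :=
    fun i hi => by simpa using hF _ hi
  refine ⟨(Finset.finite_toSet _).subset hsub, ?_⟩
  rw [finsum_eq_sum_of_support_subset _ hsub]
  exact Finset.sum_preimage e F he.injOn t fun k _ hk => hr k hk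

section SchurSeries

variable {R : Type*} [CommRing R] [Algebra ℚ R]

open MvPolynomial in
/-- The series `∑ w_{ij} s_{ij}` of signed Schur polynomials in two variables, written in the
elementary symmetric polynomials and graded by a formal variable of degree `i + j`. -/
def schurSeries (w : ℕ → ℕ → R) : PowerSeries (MvPolynomial (Fin 2) R) :=
  PowerSeries.mk fun n => ∑ p ∈ Finset.HasAntidiagonal.antidiagonal n,
    C (w p.1 p.2) * MvPolynomial.map (algebraMap ℚ R) (signedSchur p.1 p.2)

/-- The sum over `A₂ × A₂` is the coefficient of `e_ξ` in a product of two series of Schur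
polynomials. -/
theorem finsum_kostkaConv {ξ : IntPartition} (hξ : ξ.PartsLE 2) (w w' : ℕ → ℕ → R) :
    (Function.support fun p : A₂ × A₂ => (sgnTau p.1 * sgnTau p.2 *
      kostkaConv ξ (straighten p.1) (straighten p.2)) •
        (w (p.1.1 0) (p.1.1 1) * w' (p.2.1 0) (p.2.1 1))).Finite ∧
    ∑ᶠ p : A₂ × A₂, (sgnTau p.1 * sgnTau p.2 *
      kostkaConv ξ (straighten p.1) (straighten p.2)) •
        (w (p.1.1 0) (p.1.1 1) * w' (p.2.1 0) (p.2.1 1)) =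
      (PowerSeries.coeff (ξ.size + 2) (schurSeries w * schurSeries w')).coeff ξ.mult := by
  classical
  set e : A₂ × A₂ → (ℕ × ℕ) × (ℕ × ℕ) :=
    fun p => ((p.1.1 0, p.1.1 1), (p.2.1 0, p.2.1 1)) with he
  set t : (ℕ × ℕ) × (ℕ × ℕ) → R := fun k =>
    ((signedSchur k.1.1 k.1.2 * signedSchur k.2.1 k.2.2).coeff ξ.mult) •
      (w k.1.1 k.1.2 * w' k.2.1 k.2.2) with ht
  set F : Finset ((ℕ × ℕ) × (ℕ × ℕ)) :=
    (Finset.HasAntidiagonal.antidiagonal (ξ.size + 2)).biUnion fun n =>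
      Finset.HasAntidiagonal.antidiagonal n.1 ×ˢ Finset.HasAntidiagonal.antidiagonal n.2 with hF
  have heq : (fun p : A₂ × A₂ => (sgnTau p.1 * sgnTau p.2 *
      kostkaConv ξ (straighten p.1) (straighten p.2)) •
        (w (p.1.1 0) (p.1.1 1) * w' (p.2.1 0) (p.2.1 1))) = fun p => t (e p) := by
    funext p
    rw [sgnTau_mul_kostkaConv hξ]
  have hinj : Function.Injective e := by
    rintro ⟨⟨u, hu⟩, ⟨v, hv⟩⟩ ⟨⟨u', hu'⟩, ⟨v', hv'⟩⟩ h
    simp only [he, Prod.mk.injEq] at h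
    obtain ⟨⟨h1, h2⟩, h3, h4⟩ := h
    simp only [Prod.mk.injEq, Subtype.mk.injEq]
    constructor <;> funext i <;> fin_cases i <;> assumption
  have hsupp : ∀ k, t k ≠ 0 → k ∈ F := by
    rintro ⟨⟨i, j⟩, ⟨k, l⟩⟩ h
    have h0 : (signedSchur i j * signedSchur k l).coeff ξ.mult ≠ 0 := fun h0 => h (by
      simp only [ht]; rw [h0, zero_smul])
    rw [MvPolynomial.coeff_mul] at h0
    obtain ⟨m, hm, hne⟩ := Finset.exists_ne_zero_of_sum_ne_zero h0
    rw [Finset.HasAntidiagonal.mem_antidiagonal] at hm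
    have h1 := degree_of_coeff_signedSchur_ne_zero (left_ne_zero_of_mul hne)
    have h2 := degree_of_coeff_signedSchur_ne_zero (right_ne_zero_of_mul hne)
    have hs := IntPartition.size_eq_of_partsLE hξ
    rw [← hm, Finsupp.add_apply, Finsupp.add_apply] at hs
    rw [hF, Finset.mem_biUnion]
    refine ⟨(i + j, k + l), ?_, ?_⟩
    · rw [Finset.HasAntidiagonal.mem_antidiagonal]
      simp only
      omega
    · simp
  have hrange : ∀ k, k ∉ Set.range e → t k = 0 := by
    rintro ⟨⟨i, j⟩, ⟨k, l⟩⟩ h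
    simp only [ht]
    by_cases hij : i = j
    · rw [hij, signedSchur_self, zero_mul, MvPolynomial.coeff_zero, zero_smul]
    · by_cases hkl : k = l
      · rw [hkl, signedSchur_self, mul_zero, MvPolynomial.coeff_zero, zero_smul]
      · exact absurd ⟨(⟨![i, j], by simpa using hij⟩, ⟨![k, l], by simpa using hkl⟩),
          by simp [he]⟩ h
  rw [heq]
  obtain ⟨h1, h2⟩ := finsum_comp_eq_sum hinj F hsupp hrange
  refine ⟨h1, h2.trans ?_⟩
  rw [hF, Finset.sum_biUnion, PowerSeries.coeff_mul, MvPolynomial.coeff_sum]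
  · refine Finset.sum_congr rfl fun n _ => ?_
    rw [schurSeries, schurSeries, PowerSeries.coeff_mk, PowerSeries.coeff_mk, Finset.sum_mul_sum,
      ← Finset.sum_product', MvPolynomial.coeff_sum]
    refine Finset.sum_congr rfl fun k _ => ?_
    rw [mul_mul_mul_comm, ← map_mul, ← map_mul, MvPolynomial.coeff_C_mul, MvPolynomial.coeff_map,
      mul_comm, ← Algebra.smul_def]
  · intro n _ n' _ hn
    rw [Function.onFun, Finset.disjoint_left]
    rintro k hk hk'
    simp only [Finset.mem_product, Finset.HasAntidiagonal.mem_antidiagonal] at hk hk'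
    exact hn (Prod.ext (hk.1.symm.trans hk'.1) (hk.2.symm.trans hk'.2))

/-- The sum over two-row partitions is the coefficient of `e_ξ` in a series of Schur polynomials. -/
theorem finsum_kostkaInv {ξ : IntPartition} (hξ : ξ.PartsLE 2) (c : ℚ) (w : ℕ → ℕ → R) :
    (Function.support fun l : PartSeq 2 =>
      (c * kostkaInv ξ (IntPartition.ofSeq l.1).conj) • w (l.1 0 + 1) (l.1 1)).Finite ∧
    ∑ᶠ l : PartSeq 2, (c * kostkaInv ξ (IntPartition.ofSeq l.1).conj) • w (l.1 0 + 1) (l.1 1) =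
      c • (PowerSeries.coeff (ξ.size + 1)
        (schurSeries fun i j => if j < i then w i j else 0)).coeff ξ.mult := by
  set e : PartSeq 2 → ℕ × ℕ := fun l => (l.1 0 + 1, l.1 1) with he
  set t : ℕ × ℕ → R := fun k =>
    (c * (signedSchur k.1 k.2).coeff ξ.mult) • if k.2 < k.1 then w k.1 k.2 else 0 with ht
  have hle : ∀ l : PartSeq 2, l.1 1 ≤ l.1 0 := fun l => l.2 (Fin.zero_le 1)
  have heq : (fun l : PartSeq 2 => (c * kostkaInv ξ (IntPartition.ofSeq l.1).conj) •
      w (l.1 0 + 1) (l.1 1)) = fun l => t (e l) := by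
    funext l
    have := hle l
    simp only [ht, he]
    rw [kostkaInv_eq_coeff_signedSchur hξ l.2, if_pos (by omega)]
  have hinj : Function.Injective e := by
    rintro ⟨u, hu⟩ ⟨u', hu'⟩ h
    simp only [he, Prod.mk.injEq, Nat.add_right_cancel_iff] at h
    obtain ⟨h1, h2⟩ := h
    simp only [Subtype.mk.injEq]
    funext i
    fin_cases i <;> assumption
  rw [heq]
  obtain ⟨h1, h2⟩ := finsum_comp_eq_sum (t := t) hinj
    (Finset.HasAntidiagonal.antidiagonal (ξ.size + 1)) (by
      rintro ⟨i, j⟩ h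
      have h0 : (signedSchur i j).coeff ξ.mult ≠ 0 := fun h0 => h (by
        simp only [ht]; rw [h0, mul_zero, zero_smul])
      have hd := degree_of_coeff_signedSchur_ne_zero h0
      have hs := IntPartition.size_eq_of_partsLE hξ
      rw [Finset.HasAntidiagonal.mem_antidiagonal]
      simp only
      omega) (by
      rintro ⟨i, j⟩ h
      simp only [ht]
      rw [if_neg, smul_zero]
      intro hij
      refine h ⟨⟨![i - 1, j], ?_⟩, ?_⟩
      · rw [Fin.antitone_iff_succ_le]
        intro k
        fin_cases k
        simp
        omega
      · simp [he, Nat.sub_add_cancel (show 1 ≤ i by omega)])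
  refine ⟨h1, h2.trans ?_⟩
  rw [schurSeries, PowerSeries.coeff_mk, MvPolynomial.coeff_sum, Finset.smul_sum]
  refine Finset.sum_congr rfl fun k _ => ?_
  rw [MvPolynomial.coeff_C_mul, MvPolynomial.coeff_map, mul_comm, ← Algebra.smul_def, ← mul_smul]

end SchurSeries

/-! ### Passing from elementary symmetric polynomials to the variables -/

section Substitution
open MvPolynomial

variable {R : Type*} [CommRing R]

/-- The substitution `X 0 ↦ y + z`, `X 1 ↦ y z`, where `y`, `z` are the two variables. -/
def symmSubst (R : Type*) [CommRing R] : MvPolynomial (Fin 2) R →+* MvPolynomial (Fin 2) R :=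
  eval₂Hom C ![X 0 + X 1, X 0 * X 1]

/-- The elementary symmetric polynomials are algebraically independent. -/
theorem symmSubst_injective : Function.Injective (symmSubst R) := by
  have h : ∀ p, symmSubst R p = (esymmAlgHom (Fin 2) R 2 p).val := by
    intro p
    rw [esymmAlgHom_apply]
    change aeval _ p = _
    congr 2
    funext i
    fin_cases i
    · simp [esymm_one]
    · have : Finset.powersetCard 2 (Finset.univ : Finset (Fin 2)) = {Finset.univ} := by decide
      simp [esymm, this]
  intro p p' hp
  rw [h, h] at hp
  exact esymmAlgHom_fin_injective R le_rfl (Subtype.ext hp)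

/-- An equality of power series in the elementary symmetric polynomials may be checked in the
variables, after multiplication by `(y - z)²`. -/
theorem eq_of_sub_sq_mul_map_eq [IsDomain R] {f g : PowerSeries (MvPolynomial (Fin 2) R)}
    (h : PowerSeries.C (X 0 - X 1) ^ 2 *
        PowerSeries.map (symmSubst R) f =
      PowerSeries.C (X 0 - X 1) ^ 2 *
        PowerSeries.map (symmSubst R) g) : f = g := by
  have hne : (X 0 - X 1 : MvPolynomial (Fin 2) R) ≠ 0 := by
    rw [sub_ne_zero]
    exact fun h => absurd (X_injective h) (by decide)
  have hne' : PowerSeries.C (X 0 - X 1 : MvPolynomial (Fin 2) R) ≠ 0 :=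
    (map_ne_zero_iff _ PowerSeries.C_injective).mpr hne
  exact PowerSeries.map_injective _ symmSubst_injective (mul_left_cancel₀ (pow_ne_zero 2 hne') h)

variable [Algebra ℚ R]

theorem sub_mul_map_schurSeries (w : ℕ → ℕ → R) :
    PowerSeries.C (X 0 - X 1) *
        PowerSeries.map (symmSubst R) (schurSeries w) =
      biSeries (fun i j => C (w i j)) (X 0) (X 1) -
        biSeries (fun i j => C (w i j)) (X 1) (X 0) := by
  ext1 n
  rw [PowerSeries.coeff_C_mul, PowerSeries.coeff_map, schurSeries, map_sub, biSeries, biSeries,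
    PowerSeries.coeff_mk, PowerSeries.coeff_mk, PowerSeries.coeff_mk, map_sum, Finset.mul_sum,
    ← Finset.sum_sub_distrib]
  refine Finset.sum_congr rfl fun p _ => ?_
  have h := sub_mul_map_signedSchur ((symmSubst R).comp
    (MvPolynomial.map (algebraMap ℚ R))) (y := X 0) (z := X 1) (by simp [symmSubst])
    (by simp [symmSubst]) p.1 p.2
  rw [RingHom.comp_apply] at h
  have hC : (symmSubst R) (C (w p.1 p.2)) = C (w p.1 p.2) := by
    simp [symmSubst]
  rw [map_mul, hC, mul_left_comm, h]
  ring

/-- Weights that split as a product turn the series of Schur polynomials into a `2 × 2`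
determinant. -/
theorem sub_mul_map_schurSeries_mul (a b : ℕ → R) :
    PowerSeries.C (X 0 - X 1) * PowerSeries.map (symmSubst R)
        (schurSeries fun i j => a i * b j) =
      PowerSeries.rescale (X 0) (PowerSeries.mk fun i => C (a i)) *
          PowerSeries.rescale (X 1) (PowerSeries.mk fun i => C (b i)) -
        PowerSeries.rescale (X 1) (PowerSeries.mk fun i => C (a i)) *
          PowerSeries.rescale (X 0) (PowerSeries.mk fun i => C (b i)) := by
  rw [sub_mul_map_schurSeries, ← biSeries_mul, ← biSeries_mul]
  simp only [map_mul]

/-- For antisymmetric weights, the sum over `j < i` is turned into a sum over all `i`, `j`. -/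
theorem sub_mul_map_schurSeries_antisymm {w : ℕ → ℕ → R} (hw : ∀ i j, w i j = -w j i)
    (hw0 : ∀ i, w i i = 0) :
    PowerSeries.C (X 0 - X 1) * PowerSeries.map (symmSubst R)
        (schurSeries fun i j => if j < i then w i j else 0) =
      biSeries (fun i j => C (w i j)) (X 0) (X 1) := by
  rw [sub_mul_map_schurSeries, biSeries_swap _ (X 1), sub_eq_iff_eq_add, ← biSeries_add]
  congr 1
  funext i j
  rw [← map_add]
  congr 1
  rcases lt_trichotomy i j with h | rfl | h
  · rw [if_neg (by omega), if_pos h, hw i j]; ring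
  · simp [hw0]
  · rw [if_pos h, if_neg (by omega), add_zero]

end Substitution

/-! ### The two product identities -/

section Identities
open MvPolynomial
variable {ι R : Type*} [Fintype ι] [CommRing R] (x : ι → R)

theorem mk_C_q_even : (PowerSeries.mk fun i : ℕ => (C (q x (2 * i)) : MvPolynomial (Fin 2) R)) =
    evenPart (qSeries (C ∘ x)) := by
  ext1 n
  rw [PowerSeries.coeff_mk, evenPart, PowerSeries.coeff_mk, map_q, ← q_natCast]
  push_cast
  rfl

theorem mk_C_q_odd : (PowerSeries.mk fun i : ℕ => (C (q x (2 * i + 1)) : MvPolynomial (Fin 2) R)) =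
    oddPart (qSeries (C ∘ x)) := by
  ext1 n
  rw [PowerSeries.coeff_mk, oddPart, PowerSeries.coeff_mk, map_q, ← q_natCast]
  push_cast
  rfl

/-- The constant term vanishes because `q_{-1} = 0`. -/
theorem mk_C_q_pred : (PowerSeries.mk fun i : ℕ => (C (q x (2 * i - 1)) : MvPolynomial (Fin 2) R)) =
    PowerSeries.X * oddPart (qSeries (C ∘ x)) := by
  ext1 n
  cases n with
  | zero => simp [q]
  | succ n =>
    rw [PowerSeries.coeff_mk, PowerSeries.coeff_succ_X_mul, oddPart, PowerSeries.coeff_mk, map_q,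
      ← q_natCast]
    congr 1
    push_cast
    ring

theorem C_Q₂_sum_elim (r s : ℕ) : (C (Q₂ (Sum.elim x x) r s) : MvPolynomial (Fin 2) R) =
    Q₂ (Sum.elim (C ∘ x) (C ∘ x)) r s := by
  rw [map_Q₂, Sum.comp_elim]

variable [Algebra ℚ R]

/-- Compare the coefficients of `t^(n + 2)` on the two sides of `4 S_u S_v = t S_w`. -/
theorem coeff_eq_smul_coeff {ξ : IntPartition} {u v w : ℕ → ℕ → R}
    (h : 4 * (schurSeries u * schurSeries v) =
      PowerSeries.X * schurSeries fun i j => if j < i then w i j else 0) (n : ℕ) :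
    (PowerSeries.coeff (n + 2) (schurSeries u * schurSeries v)).coeff ξ.mult =
      ((2 : ℚ) ^ (-2 : ℤ)) • (PowerSeries.coeff (n + 1)
        (schurSeries fun i j => if j < i then w i j else 0)).coeff ξ.mult := by
  have h' := congrArg (PowerSeries.coeff (n + 1 + 1)) h
  rw [PowerSeries.coeff_succ_X_mul, show (4 : PowerSeries (MvPolynomial (Fin 2) R)) =
    PowerSeries.C (C 4) by rw [map_ofNat, map_ofNat], PowerSeries.coeff_C_mul] at h'
  rw [← h', coeff_C_mul, Algebra.smul_def, ← mul_assoc,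
    show (4 : R) = algebraMap ℚ R 4 from (map_ofNat _ 4).symm, ← map_mul]
  norm_num

variable [IsDomain R]

theorem Q₂_self (r : ℕ) : Q₂ x r r = 0 := by
  have := algebraRat.charZero R
  have h := Q₂_antisymm x r r
  exact self_eq_neg.mp h

theorem schurSeries_mul_schurSeries_even :
    4 * (schurSeries (fun i j => q x (2 * i) * q x (2 * j + 1)) *
        schurSeries (fun i j => q x (2 * i) * q x (2 * j + 1))) =
      PowerSeries.X * schurSeries (fun i j =>
        if j < i then Q₂ (Sum.elim x x) (2 * i + 2) (2 * j + 2) else 0) := by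
  apply eq_of_sub_sq_mul_map_eq
  have h1 := sub_mul_map_schurSeries_mul (fun i : ℕ => q x (2 * i)) (fun j : ℕ => q x (2 * j + 1))
  have h2 := sub_mul_map_schurSeries_antisymm
    (w := fun i j => Q₂ (Sum.elim x x) (2 * i + 2) (2 * j + 2))
    (fun i j => Q₂_antisymm _ _ _) (fun i => Q₂_self _ _)
  simp only [C_Q₂_sum_elim] at h2
  rw [mk_C_q_even, mk_C_q_odd] at h1
  have h3 := X_mul_biSeries_even (C ∘ x) (X 0 : MvPolynomial (Fin 2) R) (X 1)
  rw [← h1, ← h2] at h3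
  rw [map_mul, map_mul, map_mul, map_ofNat, PowerSeries.map_X]
  linear_combination -h3

theorem schurSeries_mul_schurSeries_odd :
    4 * (schurSeries (fun i j => q x (2 * i - 1) * q x (2 * j)) *
        schurSeries (fun i j => q x (2 * i) * q x (2 * j + 1))) =
      PowerSeries.X * schurSeries (fun i j =>
        if j < i then Q₂ (Sum.elim x x) (2 * i + 1) (2 * j + 1) else 0) := by
  apply eq_of_sub_sq_mul_map_eq
  have h1 := sub_mul_map_schurSeries_mul (fun i : ℕ => q x (2 * i)) (fun j : ℕ => q x (2 * j + 1))
  have h1' := sub_mul_map_schurSeries_mul (fun i : ℕ => q x (2 * i - 1)) (fun j : ℕ => q x (2 * j))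
  have h2 := sub_mul_map_schurSeries_antisymm
    (w := fun i j => Q₂ (Sum.elim x x) (2 * i + 1) (2 * j + 1))
    (fun i j => Q₂_antisymm _ _ _) (fun i => Q₂_self _ _)
  simp only [C_Q₂_sum_elim] at h2
  rw [mk_C_q_even, mk_C_q_odd] at h1
  rw [mk_C_q_even, mk_C_q_pred, map_mul, map_mul, PowerSeries.rescale_X,
    PowerSeries.rescale_X] at h1'
  have h3 := X_mul_biSeries_odd (C ∘ x) (X 0 : MvPolynomial (Fin 2) R) (X 1)
  rw [← h1, ← h2, ← h1'] at h3
  rw [map_mul, map_mul, map_mul, map_ofNat, PowerSeries.map_X]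
  linear_combination -h3

end Identities

/-! ### Pfaffians of size two -/

theorem schurQ_one {ι R : Type*} [Fintype ι] [CommRing R] (x : ι → R) (l : Fin 2 → ℕ) :
    schurQ x 1 l = Q₂ x (l 0) (l 1) := by
  have : (Finset.univ.filter fun σ : Equiv.Perm (Fin (2 * 1)) =>
      (∀ i : Fin 1, σ ⟨2 * i, by omega⟩ < σ ⟨2 * i + 1, by omega⟩) ∧
      (∀ i j : Fin 1, i < j → σ ⟨2 * i, by omega⟩ < σ ⟨2 * j, by omega⟩)) = {1} := by decide
  rw [schurQ, pfaffian, this]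
  simp

end

end SchurQ

theorem mainTheorem2 (N : ℕ) (ξ : IntPartition) (hξ : ξ.PartsLE 2) :
    let x : Fin N → MvPolynomial (Fin N) ℚ := MvPolynomial.X
    let xx : Fin N ⊕ Fin N → MvPolynomial (Fin N) ℚ := Sum.elim x x
    let lhsEven : A₂ × A₂ → MvPolynomial (Fin N) ℚ := fun (u, v) =>
      (sgnTau u * sgnTau v * kostkaConv ξ (straighten u) (straighten v)) •
        (q x (2 * u.1 0) * q x (2 * u.1 1 + 1) * q x (2 * v.1 0) * q x (2 * v.1 1 + 1))
    let rhsEven : PartSeq 2 → MvPolynomial (Fin N) ℚ := fun l =>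
      ((2 : ℚ) ^ (-2 : ℤ) * kostkaInv ξ (IntPartition.ofSeq l.1).conj) •
        schurQ xx 1 (fun i => 2 * l.1 i + 2 * Delta 2 i)
    let lhsOdd : A₂ × A₂ → MvPolynomial (Fin N) ℚ := fun (u, v) =>
      (sgnTau u * sgnTau v * kostkaConv ξ (straighten u) (straighten v)) •
        (q x (2 * u.1 0 - 1) * q x (2 * u.1 1) * q x (2 * v.1 0) * q x (2 * v.1 1 + 1))
    let rhsOdd : PartSeq 2 → MvPolynomial (Fin N) ℚ := fun l =>
      ((2 : ℚ) ^ (-2 : ℤ) * kostkaInv ξ (IntPartition.ofSeq l.1).conj) •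
        schurQ xx 1 (fun i => 2 * l.1 i + Delta 2 i + delta 2 i)
    (lhsEven.support.Finite ∧ rhsEven.support.Finite ∧
      ∑ᶠ p, lhsEven p = ∑ᶠ l, rhsEven l) ∧
    (lhsOdd.support.Finite ∧ rhsOdd.support.Finite ∧
      ∑ᶠ p, lhsOdd p = ∑ᶠ l, rhsOdd l) := by
  intro x xx lhsEven rhsEven lhsOdd rhsOdd
  obtain ⟨fL, sL⟩ := finsum_kostkaConv hξ (fun i j => q x (2 * i) * q x (2 * j + 1))
    (fun i j => q x (2 * i) * q x (2 * j + 1))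
  obtain ⟨fR, sR⟩ := finsum_kostkaInv hξ ((2 : ℚ) ^ (-2 : ℤ))
    (fun i j => Q₂ xx (2 * i + 2) (2 * j + 2))
  obtain ⟨fL', sL'⟩ := finsum_kostkaConv hξ (fun i j => q x (2 * i - 1) * q x (2 * j))
    (fun i j => q x (2 * i) * q x (2 * j + 1))
  obtain ⟨fR', sR'⟩ := finsum_kostkaInv hξ ((2 : ℚ) ^ (-2 : ℤ))
    (fun i j => Q₂ xx (2 * i + 1) (2 * j + 1))
  rw [coeff_eq_smul_coeff (schurSeries_mul_schurSeries_even x), ← sR] at sL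
  rw [coeff_eq_smul_coeff (schurSeries_mul_schurSeries_odd x), ← sR'] at sL'
  simp only [← mul_assoc] at fL sL fL' sL'
  have hR : rhsEven = fun l : PartSeq 2 => ((2 : ℚ) ^ (-2 : ℤ) *
      kostkaInv ξ (IntPartition.ofSeq l.1).conj) •
        Q₂ xx (2 * (l.1 0 + 1) + 2) (2 * l.1 1 + 2) := by
    funext l
    simp only [rhsEven]
    rw [schurQ_one]
    rfl
  have hR' : rhsOdd = fun l : PartSeq 2 => ((2 : ℚ) ^ (-2 : ℤ) *
      kostkaInv ξ (IntPartition.ofSeq l.1).conj) •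
        Q₂ xx (2 * (l.1 0 + 1) + 1) (2 * l.1 1 + 1) := by
    funext l
    simp only [rhsOdd]
    rw [schurQ_one]
    rfl
  rw [hR, hR']
  exact ⟨⟨fL, fR, sL⟩, fL', fR', sL'⟩
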